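/- Let $g\ge 1$ be an integer. Put $$u(x)=x^g+u_1x^{g-1}+\cdots+u_g,\quad v(x)=v_2x^{g-1}+v_3x^{g-2}+\cdots+v_{g+1},\quad w(x)=x^{g+2}+w_1x^{g+1}+\cdots+w_{g+2},$$ and let $\mathcal A'=\mathbb C[u_1,\dots,u_g,v_2,\dots,v_{g+1},w_1,\dots,w_{g+2}]$ be the affine ring of the phase space of the even Mumford system. Its commuting vector fields $D_1,\dots,D_g$ are the derivations of $\mathcal A'$ determined, with $D(x)=\sum_{i=1}^g x^{g-i}D_i$ and $\alpha(x)=x+w_1-u_1$, by $$D(x_2)u(x_1)=\frac{u(x_1)v(x_2)-v(x_1)u(x_2)}{x_1-x_2},$$ $$D(x_2)v(x_1)=\frac12\Bigl(\frac{w(x_1)u(x_2)-u(x_1)w(x_2)}{x_1-x_2}-\alpha(x_1+x_2)u(x_1)u(x_2)\Bigr),$$ $$D(x_2)w(x_1)=\frac{v(x_1)w(x_2)-w(x_1)v(x_2)}{x_1-x_2}+\alpha(x_1+x_2)v(x_1)u(x_2).$$ They annihilate the coefficients of $u(x)w(x)+v(x)^2$, hence act on the quotient ring $\mathcal A'_0$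 of $\mathcal A'$ by the relation $u(x)w(x)+v(x)^2=x^{2g+2}$. Let $C_0^{*'}$ be the complex whose term $C_0^{k'}$ is the $k$-th exterior power of the free $\mathcal A'_0$-module with basis $dt_1,\dots,dt_g$ $(0\le k\le g)$, with differential $d=\sum_{i=1}^g dt_i\wedge D_i$. Grade it by $\deg u_i=\deg v_i=\deg w_i=i$ and $\deg dt_i=-i$, let $(C_0^{k'})^{(n)}$ be the part of degree $n\in\mathbb Z$, and put $$\mathrm{ch}(C_0^{k'})=\sum_{n\in\mathbb Z}q^n\dim (C_0^{k'})^{(n)},\qquad \chi_q(C_0^{*'})=\sum_{k=0}^g(-1)^k\,\mathrm{ch}(C_0^{k'}).$$ Write $[k]_q=1-q^k$ and $[k]_q!=[k]_q[k-1]_q\cdots[1]_q$. Theorem. All the spaces $(C_0^{k'})^{(n)}$ are finite-dimensional, and $$\chi_q(C_0^{*'})=(-1)^g q^{-\frac12 g(g+1)}\,\frac{[1]_q\,[2g+2]_q!}{[g+1]_q!\,[g+2]_q!}$$ as Laurent series in $q$, and also as functions of $q\in\mathbb C$ with $0<|q|<1$, where the series converges. As $q\to1$ $(q \neq 1)$ the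 right-hand side, and hence also the sum of the series for $|q|<1$, tends to $$(-1)^g\left(\binom{2g+1}{g}-\binom{2g+1}{g-1}\right).$$ -/

import Mathlib

noncomputable section

open Polynomial TensorProduct

set_option linter.unusedSimpArgs false

namespace EvenMumford

/-- Index set of the coordinates: `u_{i+1}` (`i < g`), `v_{j+2}` (`j < g`), `w_{l+1}` (`l < g+2`). -/
abbrev Var (g : ℕ) : Type := Fin g ⊕ Fin g ⊕ Fin (g + 2)

/-- The affine ring `ℂ[u_1,…,u_g, v_2,…,v_{g+1}, w_1,…,w_{g+2}]` of the phase space. -/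
abbrev A (g : ℕ) : Type := MvPolynomial (Var g) ℂ

/-- `u(x) = x^g + u_1 x^{g-1} + ⋯ + u_g`. -/
def u (g : ℕ) : (A g)[X] :=
  X ^ g + ∑ i : Fin g, C (MvPolynomial.X (Sum.inl i)) * X ^ (g - 1 - (i : ℕ))

/-- `v(x) = v_2 x^{g-1} + ⋯ + v_{g+1}`. -/
def v (g : ℕ) : (A g)[X] :=
  ∑ j : Fin g, C (MvPolynomial.X (Sum.inr (Sum.inl j))) * X ^ (g - 1 - (j : ℕ))

/-- `w(x) = x^{g+2} + w_1 x^{g+1} + ⋯ + w_{g+2}`. -/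
def w (g : ℕ) : (A g)[X] :=
  X ^ (g + 2) +
    ∑ l : Fin (g + 2), C (MvPolynomial.X (Sum.inr (Sum.inr l))) * X ^ (g + 1 - (l : ℕ))

/-- `w_1 - u_1`, written through the coefficients of `x^{g+1}` in `w` and `x^{g-1}` in `u`. -/
def w1SubU1 (g : ℕ) : A g := (w g).coeff (g + 1) - (u g).coeff (g - 1)

/-! Polynomials in two variables `x₁, x₂` over a ring `R` are elements of `R[X][X]`, the inner
variable being `x₁` and the outer one `x₂`. -/

/-- `p(x₁)`. -/
abbrev at1 {R : Type*} [CommRing R] (p : R[X]) : R[X][X] := C p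

/-- `p(x₂)`. -/
abbrev at2 {R : Type*} [CommRing R] (p : R[X]) : R[X][X] := p.map C

/-- The polynomial `(p(x₁) q(x₂) - q(x₁) p(x₂)) / (x₁ - x₂)`; the division, which is exact, is
carried out by the monic polynomial `x₂ - x₁` in `x₂`. -/
def divDiff {R : Type*} [CommRing R] (p q : R[X]) : R[X][X] :=
  -((at1 p * at2 q - at1 q * at2 p) /ₘ (X - C X))

/-- `α(x₁ + x₂)`, where `α(x) = x + w_1 - u_1`. -/
def alpha (g : ℕ) : (A g)[X][X] := C X + X + C (C (w1SubU1 g))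

/-- `D(x₂) u(x₁)`. -/
def Du (g : ℕ) : (A g)[X][X] := divDiff (u g) (v g)

/-- `D(x₂) v(x₁)`. -/
def Dv (g : ℕ) : (A g)[X][X] :=
  C (C (MvPolynomial.C (1 / 2 : ℂ))) *
    (divDiff (w g) (u g) - alpha g * at1 (u g) * at2 (u g))

/-- `D(x₂) w(x₁)`. -/
def Dw (g : ℕ) : (A g)[X][X] := divDiff (v g) (w g) + alpha g * at1 (v g) * at2 (u g)

/-- The vector field `D_{i+1}` on the phase space, as a derivation of its affine ring: since
`D(x₂) = ∑ x₂^{g-i} D_i`, it sends `u_j` to the coefficient of `x₁^{g-j} x₂^{g-(i+1)}` in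
`D(x₂) u(x₁)`, and similarly for the coefficients of `v` and `w`. -/
def D (g : ℕ) (i : Fin g) : Derivation ℂ (A g) (A g) :=
  MvPolynomial.mkDerivation ℂ fun s => match s with
    | Sum.inl j => ((Du g).coeff (g - 1 - (i : ℕ))).coeff (g - 1 - (j : ℕ))
    | Sum.inr (Sum.inl j) => ((Dv g).coeff (g - 1 - (i : ℕ))).coeff (g - 1 - (j : ℕ))
    | Sum.inr (Sum.inr l) => ((Dw g).coeff (g - 1 - (i : ℕ))).coeff (g + 1 - (l : ℕ))

/-! ### The vector fields are tangent to the level sets and commute -/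

section aux

lemma fin_sum_coeff {R : Type*} [CommRing R] (N : ℕ) (x : Fin N → R) (n : ℕ) :
    (∑ i : Fin N, C (x i) * X ^ (N - 1 - (i : ℕ)) : R[X]).coeff n =
      if h : n < N then x ⟨N - 1 - n, by omega⟩ else 0 := by
  rw [finsetSum_coeff]
  simp only [coeff_C_mul, coeff_X_pow]
  split_ifs with h
  · rw [Finset.sum_eq_single ⟨N - 1 - n, by omega⟩]
    · rw [if_pos (by simp only; omega), mul_one]
    · intro b _ hb
      rw [if_neg, mul_zero]
      intro hn
      apply hb
      ext
      simp only
      omega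
    · simp
  · apply Finset.sum_eq_zero
    intro i _
    rw [if_neg (by omega), mul_zero]

lemma u_coeff_lt {g n : ℕ} (h : n < g) :
    (u g).coeff n = MvPolynomial.X (Sum.inl ⟨g - 1 - n, by omega⟩) := by
  simp only [u, coeff_add, coeff_X_pow, fin_sum_coeff, dif_pos h, if_neg h.ne, zero_add]

lemma u_coeff_self (g : ℕ) : (u g).coeff g = 1 := by
  simp only [u, coeff_add, coeff_X_pow, fin_sum_coeff]; simp

lemma u_coeff_gt {g n : ℕ} (h : g < n) : (u g).coeff n = 0 := by
  simp only [u, coeff_add, coeff_X_pow, fin_sum_coeff, if_neg h.ne', dif_neg h.asymm, zero_add]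

lemma v_coeff_lt {g n : ℕ} (h : n < g) :
    (v g).coeff n = MvPolynomial.X (Sum.inr (Sum.inl ⟨g - 1 - n, by omega⟩)) := by
  simp only [v, fin_sum_coeff, dif_pos h]

lemma v_coeff_ge {g n : ℕ} (h : g ≤ n) : (v g).coeff n = 0 := by
  simp only [v, fin_sum_coeff, dif_neg h.not_gt]

lemma w_sum_eq (g : ℕ) : w g = X ^ (g + 2) +
    ∑ l : Fin (g + 2), C (MvPolynomial.X (Sum.inr (Sum.inr l))) * X ^ (g + 2 - 1 - (l : ℕ)) := rfl

lemma w_coeff_lt {g n : ℕ} (h : n < g + 2) :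
    (w g).coeff n = MvPolynomial.X (Sum.inr (Sum.inr ⟨g + 1 - n, by omega⟩)) := by
  simp only [w_sum_eq, coeff_add, coeff_X_pow, fin_sum_coeff, dif_pos h, if_neg h.ne, zero_add]
  rfl

lemma w_coeff_self (g : ℕ) : (w g).coeff (g + 2) = 1 := by
  simp only [w_sum_eq, coeff_add, coeff_X_pow, fin_sum_coeff]; simp

lemma w_coeff_gt {g n : ℕ} (h : g + 2 < n) : (w g).coeff n = 0 := by
  simp only [w_sum_eq, coeff_add, coeff_X_pow, fin_sum_coeff, if_neg h.ne', dif_neg h.asymm,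
    zero_add]

lemma divDiff_spec {R : Type*} [CommRing R] (p q : R[X]) :
    (C X - X) * divDiff p q = at1 p * at2 q - at1 q * at2 p := by
  have : (X - C X) * ((at1 p * at2 q - at1 q * at2 p) /ₘ (X - C X)) =
      at1 p * at2 q - at1 q * at2 p := by
    rw [mul_divByMonic_eq_iff_isRoot]
    simp only [IsRoot, eval_sub, eval_mul, eval_C, eval_map, eval₂_C_X]
    ring
  rw [divDiff]
  linear_combination this

/-- `w - (x² + (w_1 - u_1) x) u`, a polynomial of degree at most `g`. -/
def resid (g : ℕ) : (A g)[X] := w g - (X ^ 2 + C (w1SubU1 g) * X) * u g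

lemma X2_coeff {R : Type*} [CommRing R] (c : R) (p : R[X]) (n : ℕ) :
    ((X ^ 2 + C c * X) * p).coeff (n + 2) = p.coeff n + c * p.coeff (n + 1) := by
  rw [add_mul, coeff_add, coeff_X_pow_mul, mul_assoc, coeff_C_mul,
    show n + 2 = (n + 1) + 1 from rfl, coeff_X_mul]

lemma resid_coeff {g n : ℕ} (hg : 0 < g) (h : g < n) : (resid g).coeff n = 0 := by
  obtain ⟨m, rfl⟩ : ∃ m, n = m + 2 := ⟨n - 2, by omega⟩
  rw [resid, coeff_sub, X2_coeff]
  rcases lt_trichotomy m g with h1 | rfl | h1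
  · obtain rfl : g = m + 1 := by omega
    rw [u_coeff_self, w1SubU1, Nat.add_sub_cancel]
    ring
  · rw [u_coeff_self, u_coeff_gt (by omega), w_coeff_self]; ring
  · rw [u_coeff_gt h1, u_coeff_gt (by omega), w_coeff_gt (by omega)]; ring

lemma Du_spec (g : ℕ) :
    (C X - X) * Du g = at1 (u g) * at2 (v g) - at1 (v g) * at2 (u g) := divDiff_spec _ _

lemma Dv_aux {R : Type*} [CommRing R] (u w : R[X]) (c h : R) :
    (C X - X) * (C (C h) * (divDiff w u - (C X + X + C (C c)) * at1 u * at2 u)) =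
      C (C h) * (at1 (w - (X ^ 2 + C c * X) * u) * at2 u -
        at1 u * at2 (w - (X ^ 2 + C c * X) * u)) := by
  have := divDiff_spec w u
  simp only [at1, at2, Polynomial.map_sub, Polynomial.map_add, Polynomial.map_mul,
    Polynomial.map_pow, map_X, map_C, C_sub, C_mul, C_add, C_pow] at this ⊢
  linear_combination C (C h) * this

lemma Dw_aux {R : Type*} [CommRing R] (u v w : R[X]) (c : R) :
    (C X - X) * (divDiff v w + (C X + X + C (C c)) * at1 v * at2 u) =
      at1 v * at2 (w - (X ^ 2 + C c * X) * u) +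
        at1 ((X ^ 2 + C c * X) * v) * at2 u - at1 w * at2 v := by
  have := divDiff_spec v w
  simp only [at1, at2, Polynomial.map_sub, Polynomial.map_add, Polynomial.map_mul,
    Polynomial.map_pow, map_X, map_C, C_mul, C_add, C_pow] at this ⊢
  linear_combination this

lemma Dv_spec (g : ℕ) :
    (C X - X) * Dv g = C (C (MvPolynomial.C (1 / 2 : ℂ))) *
      (at1 (resid g) * at2 (u g) - at1 (u g) * at2 (resid g)) :=
  Dv_aux _ _ _ _

lemma Dw_spec (g : ℕ) :
    (C X - X) * Dw g = at1 (v g) * at2 (resid g) +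
      at1 ((X ^ 2 + C (w1SubU1 g) * X) * v g) * at2 (u g) - at1 (w g) * at2 (v g) :=
  Dw_aux _ _ _ _

lemma coeff_step {R : Type*} [CommRing R] {Q N : R[X][X]} (h : (C X - X) * Q = N) (n : ℕ) :
    X * Q.coeff (n + 1) - Q.coeff n = N.coeff (n + 1) := by
  rw [← h, sub_mul, coeff_sub, coeff_C_mul, coeff_X_mul]

lemma coeff_step_zero {R : Type*} [CommRing R] {Q N : R[X][X]} (h : (C X - X) * Q = N) :
    X * Q.coeff 0 = N.coeff 0 := by
  rw [← h, sub_mul, coeff_sub, coeff_C_mul, mul_coeff_zero, coeff_X_zero, zero_mul, sub_zero]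

lemma coeff_outer {R : Type*} [CommRing R] {Q N : R[X][X]} (h : (C X - X) * Q = N) {K : ℕ}
    (hN : ∀ n, K < n → N.coeff n = 0) (n : ℕ) (hn : K ≤ n) : Q.coeff n = 0 := by
  have key : ∀ k, Q.coeff n = X ^ k * Q.coeff (n + k) := by
    intro k
    induction k with
    | zero => simp
    | succ k ih =>
      have := coeff_step h (n + k)
      rw [hN _ (by omega)] at this
      rw [ih, pow_succ, mul_assoc, ← add_assoc]
      linear_combination (-X ^ k) * this
  rw [key (Q.natDegree + 1), coeff_eq_zero_of_natDegree_lt (by omega), mul_zero]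

lemma coeff_inner {R : Type*} [CommRing R] {Q N : R[X][X]} (h : (C X - X) * Q = N) {M : ℕ}
    (hN : ∀ n m, M < m → (N.coeff n).coeff m = 0) (n m : ℕ) (hm : M ≤ m) :
    (Q.coeff n).coeff m = 0 := by
  induction n generalizing m with
  | zero =>
    rw [← coeff_X_mul, coeff_step_zero h]
    exact hN _ _ (by omega)
  | succ n ih =>
    rw [← coeff_X_mul, sub_eq_iff_eq_add.mp (coeff_step h n), coeff_add, hN _ _ (by omega),
      ih _ (by omega), add_zero]

/-- The top inner coefficient. -/
lemma coeff_inner_top {R : Type*} [CommRing R] {Q N : R[X][X]} (h : (C X - X) * Q = N) {M : ℕ}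
    (hN : ∀ n m, M < m → (N.coeff n).coeff m = 0) (n : ℕ) {M' : ℕ} (hM : M = M' + 1) :
    (Q.coeff n).coeff M' = (N.coeff n).coeff M := by
  subst hM
  cases n with
  | zero => rw [← coeff_X_mul, coeff_step_zero h]
  | succ n =>
    rw [← coeff_X_mul, sub_eq_iff_eq_add.mp (coeff_step h n), coeff_add,
      coeff_inner h hN n _ le_rfl, add_zero]

lemma cross_coeff {R : Type*} [CommRing R] (p q : R[X]) (n m : ℕ) :
    ((C p * q.map C : R[X][X]).coeff n).coeff m = p.coeff m * q.coeff n := by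
  rw [coeff_C_mul, coeff_map, coeff_mul_C]

lemma cross_coeff' {R : Type*} [CommRing R] (p q : R[X]) (n : ℕ) :
    (C p * q.map C : R[X][X]).coeff n = p * C (q.coeff n) := by
  rw [coeff_C_mul, coeff_map]

variable {g : ℕ}

lemma Nu_inner (n m : ℕ) (hm : g < m) :
    ((at1 (u g) * at2 (v g) - at1 (v g) * at2 (u g)).coeff n).coeff m = 0 := by
  simp only [coeff_sub, cross_coeff, u_coeff_gt hm, v_coeff_ge hm.le]; ring

lemma Nw_inner (n m : ℕ) (hm : g + 2 < m) :
    ((at1 (v g) * at2 (resid g) + at1 ((X ^ 2 + C (w1SubU1 g) * X) * v g) * at2 (u g) -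
      at1 (w g) * at2 (v g)).coeff n).coeff m = 0 := by
  obtain ⟨k, rfl⟩ : ∃ k, m = k + 2 := ⟨m - 2, by omega⟩
  simp only [coeff_sub, coeff_add, cross_coeff, X2_coeff, w_coeff_gt hm,
    v_coeff_ge (show g ≤ k by omega), v_coeff_ge (show g ≤ k + 1 by omega),
    v_coeff_ge (show g ≤ k + 2 by omega)]
  ring

lemma Du_inner (n m : ℕ) (hm : g ≤ m) : ((Du g).coeff n).coeff m = 0 :=
  coeff_inner (Du_spec g) Nu_inner n m hm

lemma Du_outer (n : ℕ) (hn : g ≤ n) : (Du g).coeff n = 0 :=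
  coeff_outer (Du_spec g) (fun n hn => by
    simp only [coeff_sub, cross_coeff', u_coeff_gt hn, v_coeff_ge hn.le]; simp) n hn

lemma Dv_inner (hg : 0 < g) (n m : ℕ) (hm : g ≤ m) : ((Dv g).coeff n).coeff m = 0 :=
  coeff_inner (Dv_spec g) (fun n m hm => by
    rw [coeff_C_mul, coeff_C_mul, coeff_sub, coeff_sub, cross_coeff, cross_coeff,
      u_coeff_gt hm, resid_coeff hg hm]
    simp) n m hm

lemma Dv_outer (hg : 0 < g) (n : ℕ) (hn : g ≤ n) : (Dv g).coeff n = 0 :=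
  coeff_outer (Dv_spec g) (fun n hn => by
    rw [coeff_C_mul, coeff_sub, cross_coeff', cross_coeff', u_coeff_gt hn, resid_coeff hg hn]
    simp) n hn

lemma Dw_inner (n m : ℕ) (hm : g + 2 ≤ m) : ((Dw g).coeff n).coeff m = 0 :=
  coeff_inner (Dw_spec g) Nw_inner n m hm

lemma Dw_outer (hg : 0 < g) (n : ℕ) (hn : g ≤ n) : (Dw g).coeff n = 0 :=
  coeff_outer (Dw_spec g) (fun n hn => by
    simp only [coeff_sub, coeff_add, cross_coeff', u_coeff_gt hn, resid_coeff hg hn,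
      v_coeff_ge hn.le]; simp) n hn

lemma D_u_coeff (i : Fin g) (n : ℕ) :
    D g i ((u g).coeff n) = ((Du g).coeff (g - 1 - (i : ℕ))).coeff n := by
  rcases lt_trichotomy n g with h | rfl | h
  · rw [u_coeff_lt h, D, MvPolynomial.mkDerivation_X]
    simp only
    congr 1
    omega
  · rw [u_coeff_self, Derivation.map_one_eq_zero, Du_inner _ _ le_rfl]
  · rw [u_coeff_gt h, map_zero, Du_inner _ _ h.le]

lemma D_v_coeff (i : Fin g) (n : ℕ) :
    D g i ((v g).coeff n) = ((Dv g).coeff (g - 1 - (i : ℕ))).coeff n := by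
  have hg : 0 < g := i.pos
  rcases lt_or_ge n g with h | h
  · rw [v_coeff_lt h, D, MvPolynomial.mkDerivation_X]
    simp only
    congr 1
    omega
  · rw [v_coeff_ge h, map_zero, Dv_inner hg _ _ h]

lemma D_w_coeff (i : Fin g) (n : ℕ) :
    D g i ((w g).coeff n) = ((Dw g).coeff (g - 1 - (i : ℕ))).coeff n := by
  rcases lt_trichotomy n (g + 2) with h | rfl | h
  · rw [w_coeff_lt h, D, MvPolynomial.mkDerivation_X]
    simp only
    congr 1
    omega
  · rw [w_coeff_self, Derivation.map_one_eq_zero, Dw_inner _ _ le_rfl]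
  · rw [w_coeff_gt h, map_zero, Dw_inner _ _ h.le]

/-- `D(b) = ∑ b^{g-i} D_i` for a complex number `b`. -/
def DAt (g : ℕ) (b : ℂ) : Derivation ℂ (A g) (A g) := ∑ i : Fin g, b ^ (g - 1 - (i : ℕ)) • D g i

lemma DAt_apply (b : ℂ) (p : A g) :
    DAt g b p = ∑ i : Fin g, D g i p * MvPolynomial.C b ^ (g - 1 - (i : ℕ)) := by
  have h : DAt g b p = ∑ i : Fin g, b ^ (g - 1 - (i : ℕ)) • D g i p := by
    rw [DAt, ← Derivation.coeFnAddMonoidHom_apply, map_sum, Finset.sum_apply]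
    rfl
  rw [h]
  refine Finset.sum_congr rfl fun i _ => ?_
  rw [MvPolynomial.smul_eq_C_mul, map_pow, mul_comm]

lemma sum_rev {R : Type*} [CommRing R] (N : ℕ) (f : ℕ → R) (y : R) :
    ∑ i : Fin N, f (N - 1 - (i : ℕ)) * y ^ (N - 1 - (i : ℕ)) = ∑ n ∈ Finset.range N, f n * y ^ n := by
  rw [Fin.sum_univ_eq_sum_range (fun i => f (N - 1 - i) * y ^ (N - 1 - i)) N]
  exact Finset.sum_range_reflect (fun n => f n * y ^ n) N

lemma eval_outer {R : Type*} [CommRing R] (Q : R[X][X]) (N : ℕ) (hQ : ∀ n, N ≤ n → Q.coeff n = 0)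
    (b : R) (n : ℕ) :
    (Q.eval (C b)).coeff n = ∑ k ∈ Finset.range N, (Q.coeff k).coeff n * b ^ k := by
  have hd : Q.natDegree < N ∨ Q = 0 := by
    rcases eq_or_ne Q 0 with h | h
    · exact Or.inr h
    · left
      by_contra hc
      exact h (leadingCoeff_eq_zero.mp (hQ _ (not_lt.mp hc)))
  rcases hd with hd | rfl
  · rw [eval_eq_sum_range' hd, finsetSum_coeff]
    refine Finset.sum_congr rfl fun k _ => ?_
    rw [← C_pow, coeff_mul_C]
  · simp

lemma DAt_u_coeff (b : ℂ) (n : ℕ) :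
    DAt g b ((u g).coeff n) = ((Du g).eval (C (MvPolynomial.C b))).coeff n := by
  rw [DAt_apply, eval_outer _ g Du_outer]
  simp only [D_u_coeff]
  exact sum_rev g (fun k => ((Du g).coeff k).coeff n) _

lemma DAt_v_coeff (hg : 0 < g) (b : ℂ) (n : ℕ) :
    DAt g b ((v g).coeff n) = ((Dv g).eval (C (MvPolynomial.C b))).coeff n := by
  rw [DAt_apply, eval_outer _ g (Dv_outer hg)]
  simp only [D_v_coeff]
  exact sum_rev g (fun k => ((Dv g).coeff k).coeff n) _

lemma DAt_w_coeff (hg : 0 < g) (b : ℂ) (n : ℕ) :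
    DAt g b ((w g).coeff n) = ((Dw g).eval (C (MvPolynomial.C b))).coeff n := by
  rw [DAt_apply, eval_outer _ g (Dw_outer hg)]
  simp only [D_w_coeff]
  exact sum_rev g (fun k => ((Dw g).coeff k).coeff n) _

/-- `p(a)` for a complex number `a`. -/
abbrev evC (p : (A g)[X]) (a : ℂ) : A g := p.eval (MvPolynomial.C a)

lemma der_const (Δ : Derivation ℂ (A g) (A g)) (a : ℂ) : Δ (MvPolynomial.C a) = 0 :=
  MvPolynomial.derivation_C Δ a

lemma der_eval (Δ : Derivation ℂ (A g) (A g)) (p : (A g)[X]) (a : ℂ) {N : ℕ}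
    (hN : p.natDegree < N) :
    Δ (evC p a) = ∑ n ∈ Finset.range N, Δ (p.coeff n) * MvPolynomial.C a ^ n := by
  rw [evC, eval_eq_sum_range' hN, map_sum]
  refine Finset.sum_congr rfl fun n _ => ?_
  rw [Derivation.leibniz, ← map_pow, der_const, smul_zero, zero_add, smul_eq_mul, mul_comm]

lemma der_eval_eq (Δ : Derivation ℂ (A g) (A g)) (p q : (A g)[X])
    (h : ∀ n, Δ (p.coeff n) = q.coeff n) (a : ℂ) : Δ (evC p a) = evC q a := by
  rw [der_eval Δ p a (N := p.natDegree + q.natDegree + 1) (by omega), evC,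
    eval_eq_sum_range' (n := p.natDegree + q.natDegree + 1) (by omega)]
  simp only [h]

lemma vanish {p : (A g)[X]} {s : Set ℂ} (hs : s.Finite) (h : ∀ a ∉ s, evC p a = 0) : p = 0 := by
  apply eq_zero_of_infinite_isRoot
  have : (MvPolynomial.C '' sᶜ : Set (A g)).Infinite :=
    (hs.infinite_compl).image (MvPolynomial.C_injective _ _).injOn
  refine this.mono ?_
  rintro _ ⟨a, ha, rfl⟩
  exact h a ha

section formulas

variable (a b : ℂ)

lemma DAt_u : (MvPolynomial.C a - MvPolynomial.C b : A g) * DAt g b (evC (u g) a) =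
    evC (u g) a * evC (v g) b - evC (v g) a * evC (u g) b := by
  rw [der_eval_eq _ _ _ (DAt_u_coeff b)]
  have := congrArg (evalEval (MvPolynomial.C a) (MvPolynomial.C b)) (Du_spec g)
  simpa only [evalEval_mul, evalEval_sub, evalEval_C, eval_X, evalEval_X, evalEval_map_C] using this

lemma C_half : (MvPolynomial.C (1 / 2) : A g) * 2 = 1 := by
  rw [show (2 : A g) = MvPolynomial.C 2 from (map_ofNat _ 2).symm, ← map_mul]; norm_num

lemma DAt_v (hg : 0 < g) : 2 * (MvPolynomial.C a - MvPolynomial.C b) * DAt g b (evC (v g) a) =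
    evC (w g) a * evC (u g) b - evC (u g) a * evC (w g) b -
      (MvPolynomial.C a - MvPolynomial.C b) * (MvPolynomial.C a + MvPolynomial.C b + w1SubU1 g) * evC (u g) a * evC (u g) b := by
  rw [der_eval_eq _ _ _ (DAt_v_coeff hg b)]
  have := congrArg (evalEval (MvPolynomial.C a) (MvPolynomial.C b)) (Dv_spec g)
  simp only [evalEval_mul, evalEval_sub, evalEval_C, eval_X, evalEval_X, evalEval_map_C, resid,
    eval_sub, eval_mul, eval_add, eval_pow, eval_C] at this
  linear_combination 2 * this + (
    evC (w g) a * evC (u g) b - evC (u g) a * evC (w g) b -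
      (MvPolynomial.C a - MvPolynomial.C b) * (MvPolynomial.C a + MvPolynomial.C b + w1SubU1 g) * evC (u g) a * evC (u g) b) * C_half (g := g)

lemma DAt_w (hg : 0 < g) : (MvPolynomial.C a - MvPolynomial.C b) * DAt g b (evC (w g) a) =
    evC (v g) a * evC (w g) b - evC (w g) a * evC (v g) b +
      (MvPolynomial.C a - MvPolynomial.C b) * (MvPolynomial.C a + MvPolynomial.C b + w1SubU1 g) * evC (v g) a * evC (u g) b := by
  rw [der_eval_eq _ _ _ (DAt_w_coeff hg b)]
  have := congrArg (evalEval (MvPolynomial.C a) (MvPolynomial.C b)) (Dw_spec g)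
  simp only [evalEval_mul, evalEval_sub, evalEval_add, evalEval_C, eval_X, evalEval_X,
    evalEval_map_C, resid, eval_sub, eval_mul, eval_add, eval_pow, eval_C] at this
  linear_combination this

lemma DAt_w1SubU1 (hg : 0 < g) : DAt g b (w1SubU1 g) = -2 * evC (v g) b := by
  have hv : evC (v g) b = ∑ k ∈ Finset.range g, (v g).coeff k * MvPolynomial.C b ^ k := by
    rw [evC, eval_eq_sum_range' (n := g)]
    by_contra hc
    have h0 : v g = 0 := leadingCoeff_eq_zero.mp (v_coeff_ge (not_lt.mp hc))
    rw [h0] at hc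
    simp at hc
    omega
  rw [w1SubU1, map_sub, DAt_u_coeff, DAt_w_coeff hg, eval_outer _ g Du_outer,
    eval_outer _ g (Dw_outer hg), ← Finset.sum_sub_distrib, hv, Finset.mul_sum]
  refine Finset.sum_congr rfl fun k _ => ?_
  rw [coeff_inner_top (Du_spec g) Nu_inner k (show g = g - 1 + 1 by omega),
    coeff_inner_top (Dw_spec g) Nw_inner k (show g + 2 = g + 1 + 1 by omega)]
  simp only [coeff_sub, coeff_add, cross_coeff, X2_coeff, w_coeff_self, u_coeff_self,
    v_coeff_ge (le_refl g), v_coeff_ge (show g ≤ g + 1 by omega),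
    v_coeff_ge (show g ≤ g + 2 by omega)]
  ring

end formulas

end aux


/-- The polynomial `u(x) w(x) + v(x)²`, whose coefficients are the invariants. -/
def invariant (g : ℕ) : (A g)[X] := u g * w g + v g ^ 2

section aux

variable {g : ℕ}

lemma C_sub_ne {a b : ℂ} (h : a ≠ b) : (MvPolynomial.C a - MvPolynomial.C b : A g) ≠ 0 := by
  rw [← map_sub]
  exact (map_ne_zero_iff _ (MvPolynomial.C_injective _ _)).mpr (sub_ne_zero.mpr h)

lemma DAt_invariant (hg : 0 < g) {a b : ℂ} (h : a ≠ b) : DAt g b (evC (invariant g) a) = 0 := by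
  have e : evC (invariant g) a = evC (u g) a * evC (w g) a + evC (v g) a * evC (v g) a := by
    simp only [evC, invariant, eval_add, eval_mul, eval_pow]; ring
  rw [e, map_add, Derivation.leibniz, Derivation.leibniz]
  apply mul_left_cancel₀ (C_sub_ne (g := g) h)
  simp only [smul_eq_mul, mul_zero]
  linear_combination evC (w g) a * DAt_u (g := g) a b + evC (u g) a * DAt_w a b hg +
    evC (v g) a * DAt_v a b hg

/-- Vanishing of all values forces the derivatives of the coefficients to vanish. -/
lemma der_coeff_zero {Δ : Derivation ℂ (A g) (A g)} {p : (A g)[X]} {s : Set ℂ} (hs : s.Finite)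
    (h : ∀ a ∉ s, Δ (evC p a) = 0) (n : ℕ) : Δ (p.coeff n) = 0 := by
  have h0 : ∑ k ∈ Finset.range (p.natDegree + 1), C (Δ (p.coeff k)) * X ^ k = 0 := by
    refine vanish hs fun a ha => ?_
    rw [← h a ha, der_eval Δ p a (Nat.lt_succ_self _)]
    simp [evC, eval_finsetSum]
  rcases Nat.lt_or_ge p.natDegree n with hn | hn
  · rw [coeff_eq_zero_of_natDegree_lt hn, map_zero]
  · have := congrArg (fun q => q.coeff n) h0
    simp only [finsetSum_coeff, coeff_C_mul, coeff_X_pow, coeff_zero] at this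
    simpa [Nat.lt_succ_iff, hn] using this

lemma vandermonde {x : Fin g → A g}
    (h : ∀ b : ℂ, ∑ i : Fin g, x i * MvPolynomial.C b ^ (g - 1 - (i : ℕ)) = 0) (i : Fin g) :
    x i = 0 := by
  have h0 : ∑ i : Fin g, C (x i) * X ^ (g - 1 - (i : ℕ)) = 0 := by
    refine vanish Set.finite_empty fun b _ => ?_
    simpa [evC, eval_finsetSum] using h b
  have := congrArg (fun q => q.coeff (g - 1 - (i : ℕ))) h0
  simp only [fin_sum_coeff, coeff_zero] at this
  rw [dif_pos (by omega)] at this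
  rw [← this]
  congr 1
  ext
  simp only
  omega

lemma D_invariant (i : Fin g) (n : ℕ) : D g i ((invariant g).coeff n) = 0 := by
  refine vandermonde (x := fun i => D g i ((invariant g).coeff n)) (fun b => ?_) i
  rw [← DAt_apply]
  exact der_coeff_zero (Set.finite_singleton b) (fun a ha => DAt_invariant i.pos ha) n

lemma two_ne : (2 : A g) ≠ 0 := two_ne_zero

lemma der_mul (Δ : Derivation ℂ (A g) (A g)) (p q : A g) : Δ (p * q) = p * Δ q + Δ p * q := by
  rw [Derivation.leibniz, smul_eq_mul, smul_eq_mul, mul_comm q]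

lemma der_two (Δ : Derivation ℂ (A g) (A g)) : Δ 2 = 0 := by
  rw [show (2 : A g) = MvPolynomial.C 2 from (map_ofNat _ 2).symm, der_const]

lemma comm_u (hg : 0 < g) {a b c : ℂ} (hab : a ≠ b) (hac : a ≠ c) (hbc : b ≠ c) :
    DAt g b (DAt g c (evC (u g) a)) = DAt g c (DAt g b (evC (u g) a)) := by
  have h1 := congrArg (DAt g b) (DAt_u a c (g := g))
  have h2 := congrArg (DAt g c) (DAt_u a b (g := g))
  simp only [der_mul, map_sub, map_add, der_const, der_two, sub_zero, zero_mul, add_zero, mul_zero,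
    zero_add, sub_self] at h1 h2
  have ab := C_sub_ne (g := g) hab
  have ac := C_sub_ne (g := g) hac
  have bc := C_sub_ne (g := g) hbc
  have u1 := DAt_u (g := g) a b
  have u2 := DAt_u (g := g) a c
  have u3 := DAt_u (g := g) b c
  have u4 := DAt_u (g := g) c b
  have v1 := DAt_v a b hg
  have v2 := DAt_v a c hg
  have v3 := DAt_v b c hg
  have v4 := DAt_v c b hg
  generalize evC (u g) a = ua at *
  generalize evC (u g) b = ub at *
  generalize evC (u g) c = uc at *
  generalize evC (v g) a = va at *
  generalize evC (v g) b = vb at *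
  generalize evC (v g) c = vc at *
  generalize evC (w g) a = wa at *
  generalize evC (w g) b = wb at *
  generalize evC (w g) c = wc at *
  generalize w1SubU1 g = k at *
  generalize (MvPolynomial.C a : A g) = x at *
  generalize (MvPolynomial.C b : A g) = y at *
  generalize (MvPolynomial.C c : A g) = z at *
  apply mul_left_cancel₀ (mul_ne_zero (mul_ne_zero two_ne ab) (mul_ne_zero ac bc))
  linear_combination 2 * (x - y) * (y - z) * h1 - 2 * (x - z) * (y - z) * h2
    + 2 * (y - z) * vc * u1 - (y - z) * uc * v1
    - 2 * (y - z) * vb * u2 + (y - z) * ub * v2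
    + (x - y) * (- ua * v4 + 2 * va * u4) + (x - z) * (- ua * v3 + 2 * va * u3)

lemma comm_v (hg : 0 < g) {a b c : ℂ} (hab : a ≠ b) (hac : a ≠ c) (hbc : b ≠ c) :
    DAt g b (DAt g c (evC (v g) a)) = DAt g c (DAt g b (evC (v g) a)) := by
  have h1 := congrArg (DAt g b) (DAt_v a c hg)
  have h2 := congrArg (DAt g c) (DAt_v a b hg)
  simp only [der_mul, map_sub, map_add, der_const, der_two, sub_zero, zero_mul, add_zero, mul_zero,
    zero_add, sub_self] at h1 h2
  have ab := C_sub_ne (g := g) hab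
  have ac := C_sub_ne (g := g) hac
  have bc := C_sub_ne (g := g) hbc
  have u1 := DAt_u (g := g) a b
  have u2 := DAt_u (g := g) a c
  have u3 := DAt_u (g := g) b c
  have u4 := DAt_u (g := g) c b
  have w1 := DAt_w a b hg
  have w2 := DAt_w a c hg
  have w3 := DAt_w b c hg
  have w4 := DAt_w c b hg
  have k1 := DAt_w1SubU1 b hg
  have k2 := DAt_w1SubU1 c hg
  generalize evC (u g) a = ua at *
  generalize evC (u g) b = ub at *
  generalize evC (u g) c = uc at *
  generalize evC (v g) a = va at *
  generalize evC (v g) b = vb at *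
  generalize evC (v g) c = vc at *
  generalize evC (w g) a = wa at *
  generalize evC (w g) b = wb at *
  generalize evC (w g) c = wc at *
  generalize w1SubU1 g = k at *
  generalize (MvPolynomial.C a : A g) = x at *
  generalize (MvPolynomial.C b : A g) = y at *
  generalize (MvPolynomial.C c : A g) = z at *
  apply mul_left_cancel₀ (mul_ne_zero (mul_ne_zero two_ne ab) (mul_ne_zero ac bc))
  linear_combination (x - y) * (y - z) * h1 - (x - z) * (y - z) * h2
    + (y - z) * uc * w1 - (x - y) * wa * u4 - (y - z) * wc * u1 + (x - y) * ua * w4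
    - (x - y) * (y - z) * (x - z) * ua * uc * k1 - (y - z) * (x - z) * (x + z + k) * uc * u1
    + (x - y) * (x - z) * (x + z + k) * ua * u4
    - (y - z) * ub * w2 - (x - z) * wa * u3 + (y - z) * wb * u2 + (x - z) * ua * w3
    + (x - z) * (y - z) * (x - y) * ua * ub * k2 + (y - z) * (x - y) * (x + y + k) * ub * u2
    + (x - z) * (x - y) * (x + y + k) * ua * u3

lemma comm_w (hg : 0 < g) {a b c : ℂ} (hab : a ≠ b) (hac : a ≠ c) (hbc : b ≠ c) :
    DAt g b (DAt g c (evC (w g) a)) = DAt g c (DAt g b (evC (w g) a)) := by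
  have h1 := congrArg (DAt g b) (DAt_w a c hg)
  have h2 := congrArg (DAt g c) (DAt_w a b hg)
  simp only [der_mul, map_sub, map_add, der_const, der_two, sub_zero, zero_mul, add_zero, mul_zero,
    zero_add, sub_self] at h1 h2
  have ab := C_sub_ne (g := g) hab
  have ac := C_sub_ne (g := g) hac
  have bc := C_sub_ne (g := g) hbc
  have u3 := DAt_u (g := g) b c
  have u4 := DAt_u (g := g) c b
  have v1 := DAt_v a b hg
  have v2 := DAt_v a c hg
  have v3 := DAt_v b c hg
  have v4 := DAt_v c b hg
  have w1 := DAt_w a b hg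
  have w2 := DAt_w a c hg
  have w3 := DAt_w b c hg
  have w4 := DAt_w c b hg
  have k1 := DAt_w1SubU1 b hg
  have k2 := DAt_w1SubU1 c hg
  generalize evC (u g) a = ua at *
  generalize evC (u g) b = ub at *
  generalize evC (u g) c = uc at *
  generalize evC (v g) a = va at *
  generalize evC (v g) b = vb at *
  generalize evC (v g) c = vc at *
  generalize evC (w g) a = wa at *
  generalize evC (w g) b = wb at *
  generalize evC (w g) c = wc at *
  generalize w1SubU1 g = k at *
  generalize (MvPolynomial.C a : A g) = x at *
  generalize (MvPolynomial.C b : A g) = y at *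
  generalize (MvPolynomial.C c : A g) = z at *
  apply mul_left_cancel₀ (mul_ne_zero (mul_ne_zero two_ne ab) (mul_ne_zero ac bc))
  linear_combination 2 * (x - y) * (y - z) * h1 - 2 * (x - z) * (y - z) * h2
    + (y - z) * wc * v1 - 2 * (x - y) * va * w4 - 2 * (y - z) * vc * w1 + (x - y) * wa * v4
    + 2 * (x - y) * (y - z) * (x - z) * va * uc * k1 + (y - z) * (x - z) * (x + z + k) * uc * v1
    - 2 * (x - y) * (x - z) * (x + z + k) * va * u4
    - (y - z) * wb * v2 - 2 * (x - z) * va * w3 + 2 * (y - z) * vb * w2 + (x - z) * wa * v3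
    - 2 * (x - z) * (y - z) * (x - y) * va * ub * k2 - (y - z) * (x - y) * (x + y + k) * ub * v2
    - 2 * (x - z) * (x - y) * (x + y + k) * va * u3

lemma bracket_apply' (D₁ D₂ : Derivation ℂ (A g) (A g)) (p : A g) :
    ⁅D₁, D₂⁆ p = D₁ (D₂ p) - D₂ (D₁ p) := Derivation.commutator_apply p

lemma DAt_comm (hg : 0 < g) (b c : ℂ) : ⁅DAt g b, DAt g c⁆ = 0 := by
  rcases eq_or_ne b c with rfl | hbc
  · simp
  have fin : ({b, c} : Set ℂ).Finite := by simp
  have hu : ∀ n, ⁅DAt g b, DAt g c⁆ ((u g).coeff n) = 0 := der_coeff_zero fin fun a ha => by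
    simp only [Set.mem_insert_iff, Set.mem_singleton_iff, not_or] at ha
    rw [bracket_apply', comm_u hg ha.1 ha.2 hbc, sub_self]
  have hv : ∀ n, ⁅DAt g b, DAt g c⁆ ((v g).coeff n) = 0 := der_coeff_zero fin fun a ha => by
    simp only [Set.mem_insert_iff, Set.mem_singleton_iff, not_or] at ha
    rw [bracket_apply', comm_v hg ha.1 ha.2 hbc, sub_self]
  have hw : ∀ n, ⁅DAt g b, DAt g c⁆ ((w g).coeff n) = 0 := der_coeff_zero fin fun a ha => by
    simp only [Set.mem_insert_iff, Set.mem_singleton_iff, not_or] at ha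
    rw [bracket_apply', comm_w hg ha.1 ha.2 hbc, sub_self]
  apply MvPolynomial.derivation_ext
  rintro (j | j | l)
  · have e : ∀ h, (⟨g - 1 - (g - 1 - j), h⟩ : Fin g) = j := fun _ => Fin.ext (by simp only; omega)
    have := hu (g - 1 - j)
    rwa [u_coeff_lt (by omega), e] at this
  · have e : ∀ h, (⟨g - 1 - (g - 1 - j), h⟩ : Fin g) = j := fun _ => Fin.ext (by simp only; omega)
    have := hv (g - 1 - j)
    rwa [v_coeff_lt (by omega), e] at this
  · have e : ∀ h, (⟨g + 1 - (g + 1 - l), h⟩ : Fin (g + 2)) = l := fun _ => Fin.ext (by simp only; omega)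
    have := hw (g + 1 - l)
    rwa [w_coeff_lt (by omega), e] at this

lemma D_comm (i j : Fin g) (p : A g) : D g i (D g j p) = D g j (D g i p) := by
  have hg := i.pos
  have h1 : ∀ b c, DAt g b (DAt g c p) = DAt g c (DAt g b p) := fun b c => by
    rw [← sub_eq_zero, ← bracket_apply', DAt_comm hg, Derivation.zero_apply]
  have h2 : ∀ (i : Fin g) (c : ℂ), D g i (DAt g c p) = DAt g c (D g i p) := fun i c => by
    rw [← sub_eq_zero]
    refine vandermonde (x := fun i => D g i (DAt g c p) - DAt g c (D g i p)) (fun b => ?_) i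
    simp only [sub_mul, Finset.sum_sub_distrib]
    rw [← DAt_apply, h1, DAt_apply b p, map_sum, sub_eq_zero]
    refine Finset.sum_congr rfl fun k _ => ?_
    rw [der_mul, ← map_pow, der_const, mul_zero, zero_add]
  rw [← sub_eq_zero]
  refine vandermonde (x := fun j => D g i (D g j p) - D g j (D g i p)) (fun c => ?_) j
  simp only [sub_mul, Finset.sum_sub_distrib]
  rw [← DAt_apply, ← h2, DAt_apply c p, map_sum, sub_eq_zero]
  refine Finset.sum_congr rfl fun k _ => ?_
  rw [der_mul, ← map_pow, der_const, mul_zero, zero_add]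

end aux

/-! ### The level sets, their affine rings and the complexes -/

/-- The ideal generated by the coefficients of `u(x) w(x) + v(x)² - f(x)`. -/
def levelIdeal (g : ℕ) (f : ℂ[X]) : Ideal (A g) :=
  Ideal.span (Set.range fun n => (invariant g - f.map MvPolynomial.C).coeff n)

/-- The affine ring of the level set `u(x) w(x) + v(x)² = f(x)`. -/
abbrev LevelRing (g : ℕ) (f : ℂ[X]) : Type := A g ⧸ levelIdeal g f

lemma D_mem_levelIdeal {g : ℕ} (i : Fin g) (f : ℂ[X]) {p : A g} (hp : p ∈ levelIdeal g f) :
    D g i p ∈ levelIdeal g f := by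
  induction hp using Submodule.span_induction with
  | mem x hx =>
    obtain ⟨n, rfl⟩ := hx
    simp only [coeff_sub, coeff_map, map_sub, D_invariant, der_const, sub_zero]
    exact zero_mem _
  | zero => simp
  | add x y _ _ hx hy => rw [map_add]; exact add_mem hx hy
  | smul a x hx hx' =>
    rw [smul_eq_mul, der_mul]
    exact add_mem (Ideal.mul_mem_left _ _ hx') (Ideal.mul_mem_left _ _ hx)

/-- The vector field `D_{i+1}` acting on the affine ring of the level set. -/
def levelD (g : ℕ) (f : ℂ[X]) (i : Fin g) : LevelRing g f →ₗ[ℂ] LevelRing g f :=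
  ((levelIdeal g f).restrictScalars ℂ).mapQ ((levelIdeal g f).restrictScalars ℂ)
    (D g i : A g →ₗ[ℂ] A g) fun _ hp => D_mem_levelIdeal i f hp

lemma levelD_mk (g : ℕ) (f : ℂ[X]) (i : Fin g) (p : A g) :
    levelD g f i (Ideal.Quotient.mk _ p) = Ideal.Quotient.mk _ (D g i p) := rfl

lemma levelD_comm (g : ℕ) (f : ℂ[X]) (i j : Fin g) (x : LevelRing g f) :
    levelD g f i (levelD g f j x) = levelD g f j (levelD g f i x) := by
  obtain ⟨p, rfl⟩ := Ideal.Quotient.mk_surjective x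
  rw [levelD_mk, levelD_mk, levelD_mk, levelD_mk, D_comm i j]

/-- The one-form `dt_{i+1}`. -/
def dt (g : ℕ) (i : Fin g) : Fin g → ℂ := Pi.single i 1

/-- The map `η ↦ m ∧ η` from `⋀^k M` to `⋀^{k+1} M`. -/
def wedgeLeft {M : Type*} [AddCommGroup M] [Module ℂ M] (m : M) (k : ℕ) :
    ⋀[ℂ]^k M →ₗ[ℂ] ⋀[ℂ]^(k + 1) M :=
  (LinearMap.mulLeft ℂ (ExteriorAlgebra.ι ℂ m)).restrict fun η hη => by
    change _ ∈ LinearMap.range (ExteriorAlgebra.ι ℂ) ^ (k + 1)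
    rw [pow_succ']
    exact Submodule.mul_mem_mul (LinearMap.mem_range_self _ m) hη

lemma wedgeLeft_swap {M : Type*} [AddCommGroup M] [Module ℂ M] (m m' : M) (k : ℕ) :
    wedgeLeft m (k + 1) ∘ₗ wedgeLeft m' k = -(wedgeLeft m' (k + 1) ∘ₗ wedgeLeft m k) := by
  refine LinearMap.ext fun x => Subtype.ext ?_
  change ExteriorAlgebra.ι ℂ m * (ExteriorAlgebra.ι ℂ m' * (x : ExteriorAlgebra ℂ M)) =
    -(ExteriorAlgebra.ι ℂ m' * (ExteriorAlgebra.ι ℂ m * (x : ExteriorAlgebra ℂ M)))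
  rw [← mul_assoc, ← mul_assoc, eq_neg_iff_add_eq_zero, ← add_mul,
    ExteriorAlgebra.ι_add_mul_swap, zero_mul]

/-- The `k`-th term `C_f^k`: the `k`-th exterior power of the free module over the affine ring with
basis `dt_1, …, dt_g`, realised as `LevelRing ⊗ ⋀^k ℂ^g`. -/
abbrev Cochains (g : ℕ) (f : ℂ[X]) (k : ℕ) : Type :=
  LevelRing g f ⊗[ℂ] (⋀[ℂ]^k (Fin g → ℂ))

/-- The differential `d = ∑ dt_i ∧ D_i`. -/
def differential (g : ℕ) (f : ℂ[X]) (k : ℕ) : Cochains g f k →ₗ[ℂ] Cochains g f (k + 1) :=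
  ∑ i : Fin g, TensorProduct.map (levelD g f i) (wedgeLeft (dt g i) k)

lemma sum_antisymm {N : Type*} [AddCommGroup N] [Module ℂ N] (g : ℕ) (T : Fin g → Fin g → N)
    (h : ∀ i j, T i j = -T j i) : ∑ i, ∑ j, T i j = 0 := by
  have e : ∑ i, ∑ j, T i j = -∑ i, ∑ j, T i j := by
    conv_lhs => rw [Finset.sum_comm]
    rw [← Finset.sum_neg_distrib]
    refine Finset.sum_congr rfl fun i _ => ?_
    rw [← Finset.sum_neg_distrib]
    exact Finset.sum_congr rfl fun j _ => h j i
  have h2 : (2 : ℂ) • ∑ i, ∑ j, T i j = 0 := by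
    rw [two_smul]
    nth_rewrite 1 [e]
    exact neg_add_cancel _
  exact (smul_eq_zero.mp h2).resolve_left two_ne_zero

lemma differential_comp (g : ℕ) (f : ℂ[X]) (k : ℕ) :
    differential g f (k + 1) ∘ₗ differential g f k = 0 := by
  apply TensorProduct.ext'
  intro x y
  have e : (differential g f (k + 1) ∘ₗ differential g f k) (x ⊗ₜ y) =
      ∑ i : Fin g, ∑ j : Fin g, levelD g f i (levelD g f j x) ⊗ₜ[ℂ]
        wedgeLeft (dt g i) (k + 1) (wedgeLeft (dt g j) k y) := by
    simp only [differential, LinearMap.comp_apply, LinearMap.sum_apply, TensorProduct.map_tmul,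
      map_sum]
    rw [Finset.sum_comm]
  rw [e, LinearMap.zero_apply]
  refine sum_antisymm g _ fun i j => ?_
  have h := LinearMap.congr_fun (wedgeLeft_swap (dt g i) (dt g j) k) y
  simp only [LinearMap.comp_apply, LinearMap.neg_apply] at h
  rw [h, levelD_comm, TensorProduct.tmul_neg]

/-- The complex `C_f^*` of the even Mumford system. -/
def complex (g : ℕ) (f : ℂ[X]) : CochainComplex (ModuleCat ℂ) ℕ :=
  CochainComplex.of (fun k => ModuleCat.of ℂ (Cochains g f k))
    (fun k => ModuleCat.ofHom (differential g f k)) fun k => by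
      rw [← ModuleCat.ofHom_comp, differential_comp]
      rfl

/-- The complex `C_0^*`, that is `C_f^*` for `f = x^{2g+2}`. -/
abbrev complex₀ (g : ℕ) : CochainComplex (ModuleCat ℂ) ℕ := complex g (X ^ (2 * g + 2))

/-! ### Gradings and characters -/

/-- The degrees `deg u_i = i`, `deg v_i = i`, `deg w_i = i`. -/
def varDeg (g : ℕ) : Var g → ℤ
  | Sum.inl i => (i : ℕ) + 1
  | Sum.inr (Sum.inl j) => (j : ℕ) + 2
  | Sum.inr (Sum.inr l) => (l : ℕ) + 1

/-- The degree-`n` part of the affine ring of the level set of `x^{2g+2}`: the image of the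
polynomials that are weighted homogeneous of degree `n`. -/
def ringPart (g : ℕ) (n : ℤ) : Submodule ℂ (LevelRing g (X ^ (2 * g + 2))) :=
  (MvPolynomial.weightedHomogeneousSubmodule ℂ (varDeg g) n).map
    (Ideal.Quotient.mkₐ ℂ (levelIdeal g (X ^ (2 * g + 2)))).toLinearMap

/-- The degree-`n` part of `C_0^k`, where `deg dt_i = -i`: the span of the elements
`a dt_{i_1} ∧ ⋯ ∧ dt_{i_k}` with `deg a - (i_1 + ⋯ + i_k) = n`. -/
def gradedPart (g k : ℕ) (n : ℤ) : Submodule ℂ ((complex₀ g).X k) :=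
  Submodule.span ℂ {c : Cochains g (X ^ (2 * g + 2)) k |
    ∃ (m : ℤ) (a : LevelRing g (X ^ (2 * g + 2))) (s : Fin k → Fin g),
      a ∈ ringPart g m ∧ m - ∑ l, (((s l : ℕ) : ℤ) + 1) = n ∧
        c = a ⊗ₜ[ℂ] exteriorPower.ιMulti ℂ k (fun l => dt g (s l))}

lemma ringPart_neg (g : ℕ) {n : ℤ} (hn : n < 0) : ringPart g n = ⊥ := by
  rw [eq_bot_iff]
  rintro _ ⟨p, hp, rfl⟩
  have hp : MvPolynomial.IsWeightedHomogeneous (varDeg g) p n := hp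
  have h0 : p = 0 := by
    ext d
    by_contra hd
    have h1 := hp hd
    have h2 : 0 ≤ Finsupp.weight (varDeg g) d := by
      rw [Finsupp.weight_apply]
      refine Finset.sum_nonneg fun i _ => ?_
      simp only [nsmul_eq_mul]
      refine mul_nonneg (by positivity) ?_
      rcases i with i | i | i <;> simp only [varDeg] <;> positivity
    omega
  rw [h0, map_zero]
  exact zero_mem _

lemma gradedPart_eq_bot (g k : ℕ) {n : ℤ} (hn : n < -(k * g)) : gradedPart g k n = ⊥ := by
  rw [gradedPart, Submodule.span_eq_bot]
  rintro _ ⟨m, a, s, ha, hm, rfl⟩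
  have h1 : ∑ l, (((s l : ℕ) : ℤ) + 1) ≤ k * g := by
    have := Finset.sum_le_sum (s := Finset.univ) (f := fun l => (((s l : ℕ) : ℤ) + 1))
      (g := fun _ : Fin k => (g : ℤ)) fun l _ => by have := (s l).isLt; omega
    simpa using this
  rw [ringPart_neg g (show m < 0 by linarith), Submodule.mem_bot] at ha
  rw [ha, TensorProduct.zero_tmul]
  rfl

/-- The character `ch(C_0^k) = ∑ qⁿ dim (C_0^k)^{(n)}`, a Laurent series in `q`. -/
def ch (g k : ℕ) : LaurentSeries ℚ :=
  HahnSeries.ofSuppBddBelow (fun n : ℤ => (Module.finrank ℂ (gradedPart g k n) : ℚ))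
    ⟨-(k * g), fun n hn => by
      by_contra hlt
      apply hn
      simp only
      rw [gradedPart_eq_bot g k (not_le.mp hlt), finrank_bot, Nat.cast_zero]⟩

/-- The `q`-Euler characteristic `∑ (-1)^k ch(C_0^k)` of `C_0^*`. -/
def qEulerChar (g : ℕ) : LaurentSeries ℚ := ∑ k ∈ Finset.range (g + 1), (-1) ^ k * ch g k

/-- `[k]_q = 1 - q^k`. -/
def qInt {K : Type*} [Field K] (q : K) (k : ℕ) : K := 1 - q ^ k

/-- `[k]_q! = [k]_q [k-1]_q ⋯ [1]_q`. -/
def qFact {K : Type*} [Field K] (q : K) (k : ℕ) : K := ∏ i ∈ Finset.Icc 1 k, qInt q i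

/-- `(-1)^g q^{-g(g+1)/2} [1]_q [2g+2]_q! / ([g+1]_q! [g+2]_q!)`. -/
def eulerFormula {K : Type*} [Field K] (q : K) (g : ℕ) : K :=
  (-1) ^ g * q ^ (-((g * (g + 1) / 2 : ℕ) : ℤ)) *
    (qInt q 1 * qFact q (2 * g + 2) / (qFact q (g + 1) * qFact q (g + 2)))

end EvenMumford

end

noncomputable section

open Polynomial TensorProduct

namespace EvenMumford

/-! The differential plays no role in $\chi_q$; only the Hilbert series of $\mathcal A'_0$ and the
exterior factor matter.

For fixed $v$, the level set consists of the factorisations $x^{2g+2}-v(x)^2=u(x)w(x)$ into monic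
factors of degrees $g$ and $g+2$. Generically there are $\binom{2g+2}{g}$ of them, one for each
choice of $g$ roots. Accordingly $\mathcal A'_0$ is free of that rank over $\mathbb
C[v_2,\dots,v_{g+1}]$. With $u_0=1$, a basis is given by the products of exactly $g+2$ of
$u_0,\dots,u_g$, that is, by the monomials of degree at most $g+2$ in $u_1,\dots,u_g$.

Spanning (`adjoin_coeff_le_span`): if $UW$ has coefficients in $R$, $W(0)=1$ and $\deg W\le b$, a
Toeplitz determinant of size $b+1$ in the coefficients of $U$ reduces by Cramer's rule to an
$R$-combination of products of $b$ coefficients. Expanding it straightens any product of $b+1$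
coefficients. The polynomials $u$ and $w$ enter with reversed coefficients, so that their constant
terms are $1$.

Independence (`linearIndependent_symMonomial`): over a point $v_0$ where $x^{2g+2}-v_0^2$ is
separable there are as many points as monomials, and the $u_i$ separate them. Hence the monomials
are independent as functions on the fibre, and the coefficients of a relation vanish wherever the
discriminant does not. The discriminant is a nonzero polynomial.

The basis is homogeneous, so counting gives the Hilbert series. The $u$-monomials contribute the
Gaussian binomial $[2g+2]_q!/([g]_q!\,[g+2]_q!)$ (`symGen_mul`), the $v$-monomials contribute
$\prod_{i=2}^{g+1}(1-q^i)^{-1}=[1]_q/[g+1]_q!$, and the alternating sum over the $dt$'s contributes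
$\prod_{i=1}^g(1-q^{-i})=(-1)^gq^{-g(g+1)/2}[g]_q!$. The product is computed once over an arbitrary
field in `sum_eq_eulerFormula`, and is then used both for Laurent series and for complex $q$. -/

/-! ### Monomials in the coefficients of a factor -/

section span

variable {R S : Type*} [CommRing R] [CommRing S] [Algebra R S]

/-- The `R`-span of the products of `k` coefficients of `U`. -/
def coeffProdSpan (R : Type*) {S : Type*} [CommRing R] [CommRing S] [Algebra R S] (U : S[X])
    (k : ℕ) : Submodule R S :=
  Submodule.span R (Set.range fun μ : Fin k → ℕ => ∏ i, U.coeff (μ i))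

lemma prod_mem_coeffProdSpan (U : S[X]) {ι : Type*} (s : Finset ι) (μ : ι → ℕ) :
    ∏ i ∈ s, U.coeff (μ i) ∈ coeffProdSpan R U s.card := by
  refine Submodule.subset_span ⟨fun i => μ (s.equivFin.symm i), ?_⟩
  simp only
  rw [← Finset.prod_coe_sort s, ← s.equivFin.symm.prod_comp]

/-- The two sides differ only in the cross terms, so this is the strict rearrangement inequality.
Equality would force $\sigma$ to be increasing, and the identity is the only increasing permutation.
It makes the diagonal term of a Toeplitz determinant extremal. -/
lemma sum_sq_lt_sum_sq_comp_perm {k : ℕ} {c : Fin k → ℤ} (hc : StrictMono c)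
    {σ : Equiv.Perm (Fin k)} (hσ : σ ≠ 1) :
    ∑ i, (c i - (i : ℕ)) ^ 2 < ∑ i, (c (σ i) - (i : ℕ)) ^ 2 := by
  have hid : StrictMono fun i : Fin k => ((i : ℕ) : ℤ) := fun a b h => by
    simpa using h
  have hm : Monovary c fun i : Fin k => ((i : ℕ) : ℤ) := hc.monotone.monovary hid.monotone
  have h1 : ∑ i, c (σ i) * ((i : ℕ) : ℤ) < ∑ i, c i * ((i : ℕ) : ℤ) := by
    rw [hm.sum_comp_perm_mul_lt_sum_mul_iff]
    intro h
    apply hσ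
    have h2 : StrictMono σ := by
      have : Monotone σ := by
        intro i j hij
        rcases hij.eq_or_lt with rfl | hij
        · exact le_rfl
        · exact hc.le_iff_le.mp (h (hid hij))
      exact this.strictMono_of_injective σ.injective
    have h3 : ⇑σ = id := by
      have := Subsingleton.elim (StrictMono.orderIsoOfSurjective σ h2 σ.surjective)
        (OrderIso.refl (Fin k))
      exact congrArg (fun e : Fin k ≃o Fin k => (e : Fin k → Fin k)) this
    exact Equiv.ext (congrFun h3)
  have h2 : ∑ i, c (σ i) ^ 2 = ∑ i, c i ^ 2 := Equiv.sum_comp σ fun i => c i ^ 2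
  simp only [sub_sq, Finset.sum_add_distrib, Finset.sum_sub_distrib, h2, mul_assoc,
    ← Finset.mul_sum]
  linarith

variable {U W : S[X]} {a b : ℕ}

/-- The Toeplitz matrix with rows `(u_{c_i}, u_{c_i - 1}, …)`. -/
def toeplitz (U : S[X]) {k : ℕ} (c : Fin k → ℕ) : Matrix (Fin k) (Fin k) S :=
  .of fun i l => if (l : ℕ) ≤ c i then U.coeff (c i - l) else 0

lemma toeplitz_mulVec (hW : W.natDegree ≤ b) (c : Fin (b + 1) → ℕ) :
    (toeplitz U c).mulVec (fun l => W.coeff l) = fun i => (U * W).coeff (c i) := by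
  funext i
  conv_rhs => rw [W.as_sum_range' (b + 1) (by omega), Finset.mul_sum, finsetSum_coeff]
  rw [Matrix.mulVec, dotProduct, Finset.sum_range]
  refine Finset.sum_congr rfl fun l _ => ?_
  rw [← C_mul_X_pow_eq_monomial, ← mul_assoc, coeff_mul_X_pow', coeff_mul_C, toeplitz,
    Matrix.of_apply, ite_mul, zero_mul]

/-- The Toeplitz matrix sends the vector of coefficients of $W$ to coefficients of $UW$, which are
scalars from $R$. By Cramer's rule a whole column may be replaced by these scalars, so each term of
the expansion has only $b$ factors from $U$. -/
lemma det_toeplitz_mem (hW : W.natDegree ≤ b) (hW0 : W.coeff 0 = 1)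
    (hUW : ∀ m, (U * W).coeff m ∈ (algebraMap R S).range) (c : Fin (b + 1) → ℕ) :
    (toeplitz U c).det ∈ coeffProdSpan R U b := by
  have h : (toeplitz U c).det =
      ((toeplitz U c).updateCol 0 fun i => (U * W).coeff (c i)).det := by
    -- For the Toeplitz matrix $T$ and the coefficient vector $w$,
    -- $\operatorname{adj}(T)\,Tw=\det(T)\,w$; its entry $0$ is $\det T$ because $w_0=1$.
    rw [← Matrix.cramer_apply, ← toeplitz_mulVec hW, Matrix.cramer_eq_adjugate_mulVec,
      Matrix.mulVec_mulVec, Matrix.adjugate_mul, Matrix.smul_mulVec, Matrix.one_mulVec]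
    simp [hW0]
  rw [h, Matrix.det_apply]
  refine Submodule.sum_mem _ fun σ _ => ?_
  rw [Units.smul_def]
  refine zsmul_mem ?_ _
  rw [Fin.prod_univ_succ, Matrix.updateCol_self]
  obtain ⟨r, hr⟩ := hUW (c (σ 0))
  rw [← hr, ← Algebra.smul_def]
  refine Submodule.smul_mem _ _ ?_
  simp only [Matrix.updateCol_ne (Fin.succ_ne_zero _), toeplitz, Matrix.of_apply]
  by_cases hle : ∀ i : Fin b, ((i.succ : Fin (b + 1)) : ℕ) ≤ c (σ i.succ)
  · simp only [if_pos (hle _)]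
    simpa using prod_mem_coeffProdSpan (R := R) U (Finset.univ : Finset (Fin b))
      fun i => c (σ i.succ) - ((i.succ : Fin (b + 1)) : ℕ)
  · push Not at hle
    obtain ⟨i, hi⟩ := hle
    rw [Finset.prod_eq_zero (Finset.mem_univ i) (if_neg (by omega))]
    exact zero_mem _

/-- Straightening by downward induction on $\sum\nu_i^2$. The product is the diagonal term of a
determinant lying in the span, and every other nonzero term is a product of $b+1$ coefficients with
a larger sum of squares. Once the sum exceeds $(b+1)a^2$, some index exceeds $a\ge\deg U$ and the
product is zero. The number `N` bounds the remaining distance to that threshold. -/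
lemma prod_coeff_mem (hU : U.natDegree ≤ a) (hW : W.natDegree ≤ b) (hW0 : W.coeff 0 = 1)
    (hUW : ∀ m, (U * W).coeff m ∈ (algebraMap R S).range) (N : ℕ) :
    ∀ ν : Fin (b + 1) → ℕ, (b + 1) * a ^ 2 < N + ∑ i, ν i ^ 2 →
      ∏ i, U.coeff (ν i) ∈ coeffProdSpan R U b := by
  induction N with
  | zero =>
    intro ν hν
    obtain ⟨i, hi⟩ : ∃ i, a < ν i := by
      by_contra! h
      have := Finset.sum_le_sum (s := Finset.univ) fun i _ => Nat.pow_le_pow_left (h i) 2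
      simp at this
      omega
    rw [Finset.prod_eq_zero (Finset.mem_univ i) (coeff_eq_zero_of_natDegree_lt (by omega))]
    exact zero_mem _
  | succ N ih =>
    intro ν' hν'
    set ν := ν' ∘ Tuple.sort ν' with hν
    have hmono : Monotone ν := Tuple.monotone_sort ν'
    have hprod : ∏ i, U.coeff (ν' i) = ∏ i, U.coeff (ν i) :=
      (Equiv.prod_comp (Tuple.sort ν') fun i => U.coeff (ν' i)).symm
    have hsum : ∑ i, ν' i ^ 2 = ∑ i, ν i ^ 2 :=
      (Equiv.sum_comp (Tuple.sort ν') fun i => ν' i ^ 2).symm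
    rw [hprod]
    rw [hsum] at hν'
    clear_value ν
    -- With this shift the diagonal entry of row $i$ is $u_{\nu_i}$; sorting $\nu$ first makes $c$
    -- strictly increasing.
    set c : Fin (b + 1) → ℕ := fun i => ν i + i with hc
    have hcm : StrictMono fun i => (c i : ℤ) := by
      intro i j hij
      have h1 := hmono hij.le
      have h2 : (i : ℕ) < j := hij
      simp only [hc]
      omega
    have hdet := det_toeplitz_mem (R := R) hW hW0 hUW c
    rw [Matrix.det_apply, ← Finset.add_sum_erase _ _ (Finset.mem_univ 1)] at hdet
    have hdiag : (Equiv.Perm.sign (1 : Equiv.Perm (Fin (b + 1)))) •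
        ∏ i, toeplitz U c ((1 : Equiv.Perm (Fin (b + 1))) i) i = ∏ i, U.coeff (ν i) := by
      simp [toeplitz, hc]
    rw [hdiag] at hdet
    refine (Submodule.add_mem_iff_left _ (Submodule.sum_mem _ fun σ hσ => ?_)).mp hdet
    rw [Units.smul_def]
    refine zsmul_mem ?_ _
    by_cases hle : ∀ i : Fin (b + 1), (i : ℕ) ≤ c (σ i)
    · simp only [toeplitz, Matrix.of_apply, if_pos (hle _)]
      apply ih
      have hlt := sum_sq_lt_sum_sq_comp_perm hcm (Finset.ne_of_mem_erase hσ)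
      have e1 : ∑ i, ((c i : ℤ) - (i : ℕ)) ^ 2 = ((∑ i, ν i ^ 2 : ℕ) : ℤ) := by
        push_cast [hc]
        simp
      have e2 : ∑ i, ((c (σ i) : ℤ) - (i : ℕ)) ^ 2 = ((∑ i, (c (σ i) - (i : ℕ)) ^ 2 : ℕ) : ℤ) := by
        push_cast
        exact Finset.sum_congr rfl fun i _ => by rw [Nat.cast_sub (hle i)]
      rw [e1, e2] at hlt
      have hlt := Int.ofNat_lt.mp hlt
      omega
    · push Not at hle
      obtain ⟨i, hi⟩ := hle
      rw [Finset.prod_eq_zero (Finset.mem_univ i)]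
      · exact zero_mem _
      · rw [toeplitz, Matrix.of_apply, if_neg (by omega)]

lemma coeffProdSpan_succ_le (hU : U.natDegree ≤ a) (hW : W.natDegree ≤ b) (hW0 : W.coeff 0 = 1)
    (hUW : ∀ m, (U * W).coeff m ∈ (algebraMap R S).range) :
    coeffProdSpan R U (b + 1) ≤ coeffProdSpan R U b := by
  refine Submodule.span_le.mpr ?_
  rintro _ ⟨ν, rfl⟩
  -- This `N` satisfies the bound whatever $\nu$ is.
  exact prod_coeff_mem hU hW hW0 hUW ((b + 1) * a ^ 2 + 1) ν (by omega)

lemma mul_coeff_mem_coeffProdSpan {x : S} {k : ℕ} (hx : x ∈ coeffProdSpan R U k) (i : ℕ) :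
    U.coeff i * x ∈ coeffProdSpan R U (k + 1) := by
  induction hx using Submodule.span_induction with
  | mem x hx =>
    obtain ⟨ν, rfl⟩ := hx
    refine Submodule.subset_span ⟨Fin.cons i ν, ?_⟩
    simp [Fin.prod_univ_succ]
  | zero => simp
  | add x y _ _ hx hy => rw [mul_add]; exact add_mem hx hy
  | smul r x _ hx => rw [mul_smul_comm]; exact Submodule.smul_mem _ _ hx

/-- The product of the coefficients of `U` indexed by a multiset of `b` elements of `{0, …, a}`. -/
def symMonomial (U : S[X]) {a b : ℕ} (m : Sym (Fin (a + 1)) b) : S :=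
  (Multiset.map (fun i : Fin (a + 1) => U.coeff (i : ℕ)) m).prod

lemma coeffProdSpan_le_span_symMonomial (hU : U.natDegree ≤ a) :
    coeffProdSpan R U b ≤
      Submodule.span R (Set.range fun m : Sym (Fin (a + 1)) b => symMonomial U m) := by
  refine Submodule.span_le.mpr ?_
  rintro _ ⟨ν, rfl⟩
  by_cases h : ∀ i, ν i < a + 1
  · refine Submodule.subset_span ⟨⟨Multiset.map (fun i => ⟨ν i, h i⟩) Finset.univ.val, ?_⟩, ?_⟩
    · simp
    · simp only [symMonomial, Sym.coe_mk, Multiset.map_map]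
      rfl
  · push Not at h
    obtain ⟨i, hi⟩ := h
    simp only
    rw [Finset.prod_eq_zero (Finset.mem_univ i) (coeff_eq_zero_of_natDegree_lt (by omega))]
    exact zero_mem _

/-- If `U` and `W` have constant term `1` and `U * W` has coefficients in `R`, the monomials of
degree at most `deg W` in the coefficients of `U` span the `R`-algebra they generate. -/
theorem adjoin_coeff_le_span (hU : U.natDegree ≤ a) (hW : W.natDegree ≤ b) (hU0 : U.coeff 0 = 1)
    (hW0 : W.coeff 0 = 1) (hUW : ∀ m, (U * W).coeff m ∈ (algebraMap R S).range) :
    Subalgebra.toSubmodule (Algebra.adjoin R (Set.range U.coeff)) ≤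
      Submodule.span R (Set.range fun m : Sym (Fin (a + 1)) b => symMonomial U m) := by
  refine le_trans ?_ (coeffProdSpan_le_span_symMonomial hU)
  rw [Algebra.adjoin_eq_span, Submodule.span_le]
  intro x hx
  induction hx using Submonoid.closure_induction_left with
  -- The unit is $u_0^b$, since $u_0=1$.
  | one => exact Submodule.subset_span ⟨fun _ => 0, by simp [hU0]⟩
  | mul_left x hx y _ hy =>
    obtain ⟨i, rfl⟩ := hx
    exact coeffProdSpan_succ_le hU hW hW0 hUW (mul_coeff_mem_coeffProdSpan hy i)

end span

/-! ### Independence of the monomials, by evaluation at points -/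

section independence

/-- A finite Stone–Weierstrass argument: a function separating $s$ from $t$ can be normalised to be
$1$ at $s$ and $0$ at $t$, and the product over all $t$ is the indicator of $s$. -/
lemma subalgebra_eq_top_of_separates {K ι : Type*} [Field K] [Fintype ι]
    (B : Subalgebra K (ι → K)) (h : ∀ s t, (∀ f ∈ B, f s = f t) → s = t) : B = ⊤ := by
  classical
  have hδ : ∀ s : ι, (Pi.single s 1 : ι → K) ∈ B := by
    intro s
    have h1 : ∀ t, ∃ f ∈ B, f s = 1 ∧ (t ≠ s → f t = 0) := by
      intro t
      by_cases hts : t = s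
      · exact ⟨1, one_mem _, rfl, fun h => absurd hts h⟩
      · obtain ⟨f, hf, hne⟩ : ∃ f ∈ B, f s ≠ f t := by
          by_contra! hc
          exact hts (h s t hc).symm
        refine ⟨(f s - f t)⁻¹ • (f - algebraMap K _ (f t)),
          B.smul_mem (sub_mem hf (B.algebraMap_mem _)) _, ?_, fun _ => ?_⟩
        · simp [inv_mul_cancel₀ (sub_ne_zero.mpr hne)]
        · simp
    choose F hF h1 h0 using h1
    have e : (Pi.single s 1 : ι → K) = ∏ t, F t := by
      funext t
      rw [Finset.prod_apply]
      by_cases hts : t = s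
      · subst hts
        simp [h1]
      · rw [Pi.single_eq_of_ne hts]
        exact (Finset.prod_eq_zero (f := fun c => F c t) (Finset.mem_univ t) (h0 t hts)).symm
    rw [e]
    exact prod_mem fun t _ => hF t
  rw [eq_top_iff]
  intro f _
  have e : f = ∑ s, f s • (Pi.single s 1 : ι → K) := by
    funext t
    simp [Finset.sum_apply, Pi.single_apply]
  rw [e]
  exact sum_mem fun s _ => B.smul_mem (hδ s) _

lemma map_symMonomial {S T : Type*} [CommRing S] [CommRing T] (φ : S →+* T) (U : S[X]) {a b : ℕ}
    (m : Sym (Fin (a + 1)) b) : φ (symMonomial U m) = symMonomial (U.map φ) m := by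
  simp only [symMonomial, map_multiset_prod, Multiset.map_map, coeff_map, Function.comp_def]

/-- If the points of a finite set of specialisations over one specialisation of `R` are separated
by the coefficients of `U`, and there are as many as there are monomials, then a linear relation
among the monomials becomes trivial over that specialisation. -/
theorem eval_eq_zero_of_sum_smul_symMonomial {R S K ι : Type*} [CommRing R] [CommRing S]
    [Algebra R S] [Field K] [Fintype ι] {U W : S[X]} {a b : ℕ}
    (hU : U.natDegree ≤ a) (hW : W.natDegree ≤ b) (hU0 : U.coeff 0 = 1)
    (hW0 : W.coeff 0 = 1) (hUW : ∀ m, (U * W).coeff m ∈ (algebraMap R S).range)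
    (φ : S →+* (ι → K)) (ev : R →+* K) (hφ : ∀ r s, φ (algebraMap R S r) s = ev r)
    (hsep : ∀ s t, (∀ i, φ (U.coeff i) s = φ (U.coeff i) t) → s = t)
    (hcard : Fintype.card ι = Fintype.card (Sym (Fin (a + 1)) b))
    (c : Sym (Fin (a + 1)) b → R) (hc : ∑ m, c m • symMonomial U m = 0) (m) : ev (c m) = 0 := by
  have hφ' : ∀ r, φ (algebraMap R S r) = algebraMap K (ι → K) (ev r) :=
    fun r => funext fun s => hφ r s
  -- After specialisation $R$ acts through constants in $K$, so the spanning theorem applies over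
  -- $K$; separation turns the algebra generated by the coefficients into the whole of $K^\iota$.
  have hspan := adjoin_coeff_le_span (R := K) (U := U.map φ) (W := W.map φ) (a := a) (b := b)
    (natDegree_map_le.trans hU) (natDegree_map_le.trans hW) (by rw [coeff_map, hU0, map_one])
    (by rw [coeff_map, hW0, map_one]) (fun k => by
      obtain ⟨r, hr⟩ := hUW k
      rw [← Polynomial.map_mul, coeff_map, ← hr, hφ']
      exact ⟨_, rfl⟩)
  rw [subalgebra_eq_top_of_separates (Algebra.adjoin K (Set.range (U.map φ).coeff))
    (fun s t h => hsep s t fun i => by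
      have := h _ (Algebra.subset_adjoin ⟨i, rfl⟩)
      rwa [coeff_map] at this), Algebra.top_toSubmodule] at hspan
  -- A spanning family with as many members as the dimension is independent.
  have hli : LinearIndependent K
      (fun m : Sym (Fin (a + 1)) b => symMonomial (U.map φ) m) :=
    linearIndependent_of_top_le_span_of_card_eq_finrank hspan
      (by rw [Module.finrank_fintype_fun_eq_card, hcard])
  refine Fintype.linearIndependent_iff.mp hli (fun m => ev (c m)) ?_ m
  have := congrArg φ hc
  rw [map_sum, map_zero] at this
  rw [← this]
  refine Finset.sum_congr rfl fun m _ => ?_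
  rw [Algebra.smul_def (c m), map_mul, map_symMonomial, hφ', ← Algebra.smul_def]

end independence

/-! ### Points of the level sets -/

section points

variable {g : ℕ} {f q q' p : ℂ[X]}

/-- The coordinates of the point `(u, v, w) = (q, p, q')`. -/
def pointCoord (g : ℕ) (q p q' : ℂ[X]) : Var g → ℂ
  | Sum.inl i => q.coeff (g - 1 - (i : ℕ))
  | Sum.inr (Sum.inl j) => p.coeff (g - 1 - (j : ℕ))
  | Sum.inr (Sum.inr l) => q'.coeff (g + 1 - (l : ℕ))

lemma map_u_aeval (hq : q.Monic) (hqd : q.natDegree = g) :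
    (u g).map (MvPolynomial.aeval (pointCoord g q p q')).toRingHom = q := by
  ext n
  rw [coeff_map]
  rcases lt_trichotomy n g with h | rfl | h
  · rw [u_coeff_lt h]
    simp only [AlgHom.toRingHom_eq_coe, RingHom.coe_coe, MvPolynomial.aeval_X, pointCoord]
    congr 1
    omega
  · rw [u_coeff_self, map_one, ← hqd, hq.coeff_natDegree]
  · rw [u_coeff_gt h, map_zero, coeff_eq_zero_of_natDegree_lt (by omega)]

lemma map_v_aeval (hp : ∀ n, g ≤ n → p.coeff n = 0) :
    (v g).map (MvPolynomial.aeval (pointCoord g q p q')).toRingHom = p := by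
  ext n
  rw [coeff_map]
  rcases lt_or_ge n g with h | h
  · rw [v_coeff_lt h]
    simp only [AlgHom.toRingHom_eq_coe, RingHom.coe_coe, MvPolynomial.aeval_X, pointCoord]
    congr 1
    omega
  · rw [v_coeff_ge h, map_zero, hp n h]

lemma map_w_aeval (hq : q'.Monic) (hqd : q'.natDegree = g + 2) :
    (w g).map (MvPolynomial.aeval (pointCoord g q p q')).toRingHom = q' := by
  ext n
  rw [coeff_map]
  rcases lt_trichotomy n (g + 2) with h | rfl | h
  · rw [w_coeff_lt h]
    simp only [AlgHom.toRingHom_eq_coe, RingHom.coe_coe, MvPolynomial.aeval_X, pointCoord]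
    congr 1
    omega
  · rw [w_coeff_self, map_one, ← hqd, hq.coeff_natDegree]
  · rw [w_coeff_gt h, map_zero, coeff_eq_zero_of_natDegree_lt (by omega)]

/-- Evaluation at a point of the level set. -/
def pointHom (hq : q.Monic) (hqd : q.natDegree = g) (hp : ∀ n, g ≤ n → p.coeff n = 0)
    (hq' : q'.Monic) (hqd' : q'.natDegree = g + 2) (h : q * q' + p ^ 2 = f) :
    LevelRing g f →+* ℂ :=
  Ideal.Quotient.lift (levelIdeal g f) (MvPolynomial.aeval (pointCoord g q p q')).toRingHom
    fun x hx => by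
      rw [← RingHom.mem_ker]
      refine Ideal.span_le.mpr ?_ hx
      rintro _ ⟨n, rfl⟩
      rw [SetLike.mem_coe, RingHom.mem_ker, ← coeff_map, invariant, Polynomial.map_sub,
        Polynomial.map_add, Polynomial.map_mul, Polynomial.map_pow, map_u_aeval hq hqd,
        map_v_aeval hp, map_w_aeval hq' hqd', h, Polynomial.map_map]
      have e : (MvPolynomial.aeval (pointCoord g q p q')).toRingHom.comp MvPolynomial.C =
          RingHom.id ℂ := by
        ext z
        simp
      rw [e, Polynomial.map_id, sub_self, coeff_zero]

end points

/-! ### The affine ring as a module over the polynomials in `v` -/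

section module

variable {g : ℕ} {f : ℂ[X]}

/-- The ring `ℂ[v_2, …, v_{g+1}]`. -/
abbrev VRing (g : ℕ) : Type := MvPolynomial (Fin g) ℂ

/-- The inclusion of `ℂ[v_2, …, v_{g+1}]` into the affine ring of the phase space. -/
def vIncl (g : ℕ) : VRing g →ₐ[ℂ] A g := MvPolynomial.rename fun j => Sum.inr (Sum.inl j)

instance instAlgebraVRing (g : ℕ) (f : ℂ[X]) : Algebra (VRing g) (LevelRing g f) :=
  ((Ideal.Quotient.mk (levelIdeal g f)).comp (vIncl g).toRingHom).toAlgebra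

instance instModuleVRing (g : ℕ) (f : ℂ[X]) : Module (VRing g) (LevelRing g f) :=
  Algebra.toModule

lemma algebraMap_VRing (r : VRing g) :
    algebraMap (VRing g) (LevelRing g f) r = Ideal.Quotient.mk _ (vIncl g r) := rfl

instance instScalarTowerVRing (g : ℕ) (f : ℂ[X]) :
    IsScalarTower ℂ (VRing g) (LevelRing g f) :=
  IsScalarTower.of_algebraMap_eq fun z => by
    rw [algebraMap_VRing, AlgHom.commutes]
    rfl

/-- The polynomial `v(x)` over `ℂ[v_2, …, v_{g+1}]`. -/
def vGen (g : ℕ) : (VRing g)[X] := ∑ j : Fin g, C (MvPolynomial.X j) * X ^ (g - 1 - (j : ℕ))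

lemma map_vGen : (vGen g).map (vIncl g).toRingHom = v g := by
  simp [vGen, v, vIncl, Polynomial.map_sum]

/-- The polynomial `u` over the affine ring of a level set, with reversed coefficients. -/
def uRev (g : ℕ) (f : ℂ[X]) : (LevelRing g f)[X] :=
  ((u g).map (Ideal.Quotient.mk (levelIdeal g f))).reflect g

/-- The polynomial `w` over the affine ring of a level set, with reversed coefficients. -/
def wRev (g : ℕ) (f : ℂ[X]) : (LevelRing g f)[X] :=
  ((w g).map (Ideal.Quotient.mk (levelIdeal g f))).reflect (g + 2)

lemma natDegree_u_le : (u g).natDegree ≤ g :=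
  natDegree_le_iff_coeff_eq_zero.mpr fun _ => u_coeff_gt

lemma natDegree_w_le : (w g).natDegree ≤ g + 2 :=
  natDegree_le_iff_coeff_eq_zero.mpr fun _ => w_coeff_gt

lemma natDegree_uRev : (uRev g f).natDegree ≤ g :=
  natDegree_reflect_le.trans (max_le le_rfl (natDegree_map_le.trans natDegree_u_le))

lemma natDegree_wRev : (wRev g f).natDegree ≤ g + 2 :=
  natDegree_reflect_le.trans (max_le le_rfl (natDegree_map_le.trans natDegree_w_le))

lemma uRev_coeff {i : ℕ} (hi : i ≤ g) :
    (uRev g f).coeff i = Ideal.Quotient.mk _ ((u g).coeff (g - i)) := by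
  rw [uRev, coeff_reflect, revAt_le hi, coeff_map]

lemma wRev_coeff {i : ℕ} (hi : i ≤ g + 2) :
    (wRev g f).coeff i = Ideal.Quotient.mk _ ((w g).coeff (g + 2 - i)) := by
  rw [wRev, coeff_reflect, revAt_le hi, coeff_map]

lemma uRev_coeff_zero : (uRev g f).coeff 0 = 1 := by
  rw [uRev_coeff (Nat.zero_le _), Nat.sub_zero, u_coeff_self, map_one]

lemma wRev_coeff_zero : (wRev g f).coeff 0 = 1 := by
  rw [wRev_coeff (Nat.zero_le _), Nat.sub_zero, w_coeff_self, map_one]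

/-- The equation of the level set, read as $uw=f-v^2$: the product of the two factors is defined
over $\mathbb C[v_2,\dots,v_{g+1}]$, which is what the spanning theorem requires. -/
lemma map_u_mul_map_w : (u g).map (Ideal.Quotient.mk (levelIdeal g f)) *
    (w g).map (Ideal.Quotient.mk (levelIdeal g f)) =
      (f.map MvPolynomial.C - vGen g ^ 2).map (algebraMap (VRing g) (LevelRing g f)) := by
  have h1 : (invariant g).map (Ideal.Quotient.mk (levelIdeal g f)) =
      (f.map MvPolynomial.C).map (Ideal.Quotient.mk (levelIdeal g f)) := by
    ext n
    rw [coeff_map, coeff_map, Ideal.Quotient.mk_eq_mk_iff_sub_mem, ← coeff_sub]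
    exact Ideal.subset_span ⟨n, rfl⟩
  have h2 : (vGen g).map (algebraMap (VRing g) (LevelRing g f)) =
      (v g).map (Ideal.Quotient.mk (levelIdeal g f)) := by
    rw [← map_vGen, Polynomial.map_map]
    rfl
  have h3 : (f.map (MvPolynomial.C (σ := Fin g))).map (algebraMap (VRing g) (LevelRing g f)) =
      (f.map MvPolynomial.C).map (Ideal.Quotient.mk (levelIdeal g f)) := by
    rw [Polynomial.map_map, Polynomial.map_map]
    congr 1
    ext z
    rw [RingHom.comp_apply, algebraMap_VRing, RingHom.comp_apply]
    simp [vIncl]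
  rw [Polynomial.map_sub, Polynomial.map_pow, h2, h3, ← h1, invariant, Polynomial.map_add,
    Polynomial.map_mul, Polynomial.map_pow]
  ring

lemma uRev_mul_wRev_coeff_mem (m : ℕ) :
    (uRev g f * wRev g f).coeff m ∈ (algebraMap (VRing g) (LevelRing g f)).range := by
  rw [uRev, wRev, ← reflect_mul _ _ (natDegree_map_le.trans natDegree_u_le)
    (natDegree_map_le.trans natDegree_w_le), coeff_reflect, map_u_mul_map_w, coeff_map]
  exact ⟨_, rfl⟩

end module

/-! ### The monomial basis of the affine ring of a level set -/

section basis

variable {g : ℕ} {f : ℂ[X]}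

/-- The $w_i$ are redundant: as $u_0=1$, the coefficient of index $i+1$ in the reversed product
$uw$, which comes from $\mathbb C[v]$, is $w_{i+1}$ plus products of $u$'s with earlier $w$'s. -/
lemma adjoin_uRev_coeff_eq_top :
    Algebra.adjoin (VRing g) (Set.range (uRev g f).coeff) = ⊤ := by
  set B := Algebra.adjoin (VRing g) (Set.range (uRev g f).coeff) with hB
  have hu : ∀ i, (uRev g f).coeff i ∈ B := fun i => Algebra.subset_adjoin ⟨i, rfl⟩
  have hw : ∀ i, (wRev g f).coeff i ∈ B := by
    intro i
    induction i using Nat.strong_induction_on with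
    | _ i ih =>
      rcases i with _ | i
      · rw [wRev_coeff_zero]
        exact one_mem _
      · obtain ⟨r, hr⟩ := uRev_mul_wRev_coeff_mem (g := g) (f := f) (i + 1)
        rw [coeff_mul, Finset.Nat.sum_antidiagonal_succ, uRev_coeff_zero, one_mul] at hr
        rw [← sub_eq_iff_eq_add.mpr hr]
        refine sub_mem (B.algebraMap_mem r) (sum_mem fun p hp => mul_mem (hu _) (ih _ ?_))
        have hp := Finset.HasAntidiagonal.mem_antidiagonal.mp hp
        simp only
        omega
  rw [eq_top_iff]
  intro x _
  obtain ⟨p, rfl⟩ := Ideal.Quotient.mk_surjective x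
  induction p using MvPolynomial.induction_on with
  | C z =>
    have e : Ideal.Quotient.mk (levelIdeal g f) (MvPolynomial.C z) =
        algebraMap (VRing g) (LevelRing g f) (MvPolynomial.C z) := by
      rw [algebraMap_VRing, vIncl, MvPolynomial.rename_C]
    rw [e]
    exact B.algebraMap_mem _
  | add p q hp hq => rw [map_add]; exact add_mem (hp trivial) (hq trivial)
  | mul_X p s hp =>
    rw [map_mul]
    refine mul_mem (hp trivial) ?_
    rcases s with i | j | l
    · have h := hu (i + 1)
      rw [uRev_coeff (by omega), u_coeff_lt (by omega)] at h
      convert h using 5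
      omega
    · have e : Ideal.Quotient.mk (levelIdeal g f) (MvPolynomial.X (Sum.inr (Sum.inl j))) =
          algebraMap (VRing g) (LevelRing g f) (MvPolynomial.X j) := by
        rw [algebraMap_VRing, vIncl, MvPolynomial.rename_X]
      rw [e]
      exact B.algebraMap_mem _
    · have h := hw (l + 1)
      rw [wRev_coeff (by omega), w_coeff_lt (by omega)] at h
      convert h using 6
      omega

/-- The index set of the monomials of degree at most `g + 2` in `u_1, …, u_g`. -/
abbrev UIndex (g : ℕ) : Type := Sym (Fin (g + 1)) (g + 2)

lemma span_symMonomial_eq_top : Submodule.span (VRing g)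
    (Set.range fun m : UIndex g => symMonomial (uRev g f) m) = ⊤ := by
  rw [eq_top_iff, ← Algebra.top_toSubmodule, ← adjoin_uRev_coeff_eq_top]
  exact adjoin_coeff_le_span natDegree_uRev natDegree_wRev uRev_coeff_zero wRev_coeff_zero
    uRev_mul_wRev_coeff_mem

/-- The polynomial `f - v²` over `ℂ[v_2, …, v_{g+1}]`. -/
def genFiber (g : ℕ) (f : ℂ[X]) : (VRing g)[X] := f.map MvPolynomial.C - vGen g ^ 2

lemma vGen_coeff_ge {n : ℕ} (hn : g ≤ n) : (vGen g).coeff n = 0 := by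
  rw [vGen, fin_sum_coeff, dif_neg hn.not_gt]

lemma natDegree_vGen_sq : (vGen g ^ 2).natDegree ≤ 2 * g := by
  refine natDegree_pow_le.trans (Nat.mul_le_mul_left 2 ?_)
  exact natDegree_le_iff_coeff_eq_zero.mpr fun n hn => vGen_coeff_ge hn.le

lemma monic_genFiber (hf : f.Monic) (hfd : f.natDegree = 2 * g + 2) :
    (genFiber g f).Monic := by
  refine (hf.map _).sub_of_left (degree_lt_degree ?_)
  rw [hf.natDegree_map, hfd]
  have := natDegree_vGen_sq (g := g)
  omega

lemma natDegree_genFiber (hf : f.Monic) (hfd : f.natDegree = 2 * g + 2) :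
    (genFiber g f).natDegree = 2 * g + 2 := by
  rw [genFiber, natDegree_sub_eq_left_of_natDegree_lt, hf.natDegree_map, hfd]
  rw [hf.natDegree_map, hfd]
  have := natDegree_vGen_sq (g := g)
  omega

/-- The discriminant (up to sign) of `f - v²`. -/
def genDisc (g : ℕ) (f : ℂ[X]) : VRing g :=
  resultant (genFiber g f) (derivative (genFiber g f)) (2 * g + 2) (2 * g + 1)

/-- The resultant is taken with prescribed degrees, so it commutes with specialisation. Since
$f-v^2$ is monic and the characteristic is zero, these are the true degrees at every point, and
nonvanishing means coprimality with the derivative. -/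
lemma eval_genDisc_ne_zero_iff (hf : f.Monic) (hfd : f.natDegree = 2 * g + 2)
    (v₀ : Fin g → ℂ) : MvPolynomial.eval v₀ (genDisc g f) ≠ 0 ↔
      ((genFiber g f).map (MvPolynomial.eval v₀)).Separable := by
  have hm := (monic_genFiber hf hfd).map (MvPolynomial.eval v₀)
  have hd : ((genFiber g f).map (MvPolynomial.eval v₀)).natDegree = 2 * g + 2 := by
    rw [(monic_genFiber hf hfd).natDegree_map, natDegree_genFiber hf hfd]
  have hd' : (derivative ((genFiber g f).map (MvPolynomial.eval v₀))).natDegree = 2 * g + 1 := by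
    rw [natDegree_derivative, hd]
    rfl
  rw [genDisc, ← resultant_map_map, ← derivative_map, Polynomial.Separable,
    ← isUnit_resultant_iff_isCoprime hm, hd, hd', isUnit_iff_ne_zero]

lemma eval_eq_zero_of_sum_smul (hg : 1 ≤ g) (hf : f.Monic) (hfd : f.natDegree = 2 * g + 2)
    {v₀ : Fin g → ℂ} (hv : ((genFiber g f).map (MvPolynomial.eval v₀)).Separable)
    {c : UIndex g → VRing g} (hc : ∑ m, c m • symMonomial (uRev g f) m = 0) (m : UIndex g) :
    MvPolynomial.eval v₀ (c m) = 0 := by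
  classical
  set F := (genFiber g f).map (MvPolynomial.eval v₀) with hF
  have hFm : F.Monic := (monic_genFiber hf hfd).map _
  have hFd : F.natDegree = 2 * g + 2 := by
    rw [hF, (monic_genFiber hf hfd).natDegree_map, natDegree_genFiber hf hfd]
  set Z := F.roots.toFinset with hZ
  have hsplit : F.Splits := IsAlgClosed.splits F
  have hnodup : F.roots.Nodup := nodup_roots hv
  have hZF : ∏ z ∈ Z, (X - C z) = F := by
    rw [Finset.prod, hZ, Multiset.toFinset_val, hnodup.dedup]
    exact (hsplit.eq_prod_roots_of_monic hFm).symm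
  have hZc : Z.card = 2 * g + 2 := by
    rw [hZ, Multiset.toFinset_card_of_nodup hnodup, ← hsplit.natDegree_eq_card_roots, hFd]
  -- The points over $v_0$: a set $s$ of $g$ roots gives $u=\prod_{z\in s}(x-z)$, and the
  -- complementary $g+2$ roots give $w$.
  let ι := {s : Finset ℂ // s ∈ Z.powersetCard g}
  set p := (vGen g).map (MvPolynomial.eval v₀) with hp
  have hpc : ∀ n, g ≤ n → p.coeff n = 0 := fun n hn => by
    rw [hp, coeff_map, vGen_coeff_ge hn, map_zero]
  have hpF : F = f - p ^ 2 := by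
    rw [hF, genFiber, Polynomial.map_sub, Polynomial.map_pow, Polynomial.map_map, ← hp]
    have e : (MvPolynomial.eval v₀).comp MvPolynomial.C = RingHom.id ℂ := by
      ext z
      simp
    rw [e, Polynomial.map_id]
  have hs : ∀ s : ι, s.1 ⊆ Z ∧ s.1.card = g := fun s => Finset.mem_powersetCard.mp s.2
  let q : ι → ℂ[X] := fun s => ∏ z ∈ s.1, (X - C z)
  let q' : ι → ℂ[X] := fun s => ∏ z ∈ Z \ s.1, (X - C z)
  have hqm : ∀ s, (q s).Monic := fun s => monic_prod_of_monic _ _ fun z _ => monic_X_sub_C z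
  have hqm' : ∀ s, (q' s).Monic := fun s => monic_prod_of_monic _ _ fun z _ => monic_X_sub_C z
  have hqd : ∀ s, (q s).natDegree = g := fun s => by
    rw [natDegree_prod_of_monic _ _ fun z _ => monic_X_sub_C z]
    simp [(hs s).2]
  have hqd' : ∀ s, (q' s).natDegree = g + 2 := fun s => by
    rw [natDegree_prod_of_monic _ _ fun z _ => monic_X_sub_C z]
    simp only [natDegree_X_sub_C, Finset.sum_const, smul_eq_mul, mul_one,
      Finset.card_sdiff_of_subset (hs s).1, hZc, (hs s).2]
    omega
  have hqq : ∀ s, q s * q' s + p ^ 2 = f := fun s => by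
    rw [mul_comm, Finset.prod_sdiff (hs s).1, hZF, hpF, sub_add_cancel]
  let φ : LevelRing g f →+* (ι → ℂ) :=
    RingHom.pi fun s => pointHom (hqm s) (hqd s) hpc (hqm' s) (hqd' s) (hqq s)
  have hφu : ∀ i ≤ g, ∀ s, φ ((uRev g f).coeff i) s = (q s).coeff (g - i) := by
    intro i hi s
    rw [uRev_coeff hi]
    change (MvPolynomial.aeval (pointCoord g (q s) p (q' s))).toRingHom ((u g).coeff (g - i)) = _
    rw [← coeff_map, map_u_aeval (hqm s) (hqd s)]
  refine eval_eq_zero_of_sum_smul_symMonomial natDegree_uRev natDegree_wRev uRev_coeff_zero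
    wRev_coeff_zero uRev_mul_wRev_coeff_mem φ (MvPolynomial.eval v₀) ?_ ?_ ?_ c hc m
  · intro r s
    rw [algebraMap_VRing]
    change MvPolynomial.aeval (pointCoord g (q s) p (q' s)) (vIncl g r) = _
    rw [vIncl, MvPolynomial.aeval_rename, MvPolynomial.aeval_eq_eval]
    congr 2
    funext j
    rw [Function.comp_apply, pointCoord, hp, coeff_map, vGen, fin_sum_coeff, dif_pos (by omega),
      MvPolynomial.eval_X]
    congr 1
    ext
    simp only
    omega
  -- The coefficients of $u$ determine $u$, hence its set of roots.
  · intro s t h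
    have e : q s = q t := by
      ext n
      rcases le_or_gt n g with hn | hn
      · have := h (g - n)
        rwa [hφu _ (Nat.sub_le _ _), hφu _ (Nat.sub_le _ _), Nat.sub_sub_self hn] at this
      · rw [coeff_eq_zero_of_natDegree_lt (by rw [hqd]; exact hn),
          coeff_eq_zero_of_natDegree_lt (by rw [hqd]; exact hn)]
    have e2 := congrArg Polynomial.roots e
    simp only [q, roots_prod_X_sub_C] at e2
    exact Subtype.ext (Finset.val_injective e2)
  -- There are $\binom{2g+2}{g}$ points, and $\binom{2g+2}{g+2}$ multisets of $g+2$ elements taken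
  -- from $g+1$.
  · rw [Fintype.card_coe, Finset.card_powersetCard, hZc, Sym.card_sym_fin_eq_multichoose,
      Nat.multichoose_eq, ← Nat.choose_symm (by omega)]
    congr 1 <;> omega

/-- The product of a coefficient of a relation with the discriminant vanishes at every point of
$\mathbb C^g$, so it is the zero polynomial, and the discriminant can be cancelled. -/
lemma linearIndependent_symMonomial (hg : 1 ≤ g) (hf : f.Monic) (hfd : f.natDegree = 2 * g + 2)
    (hdisc : genDisc g f ≠ 0) :
    LinearIndependent (VRing g) fun m : UIndex g => symMonomial (uRev g f) m := by
  rw [Fintype.linearIndependent_iff]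
  intro c hc m
  refine (mul_eq_zero.mp ?_).resolve_right hdisc
  refine MvPolynomial.funext fun v₀ => ?_
  rw [map_mul, map_zero]
  by_cases hv : MvPolynomial.eval v₀ (genDisc g f) = 0
  · rw [hv, mul_zero]
  · rw [eval_eq_zero_of_sum_smul hg hf hfd
      ((eval_genDisc_ne_zero_iff hf hfd v₀).mp hv) hc, zero_mul]

/-- At $v(x)=1$, that is $v_{g+1}=1$ and all other $v_j=0$, the polynomial becomes $x^{2g+2}-1$,
which is separable. -/
lemma genDisc_X_pow_ne_zero (hg : 1 ≤ g) : genDisc g (X ^ (2 * g + 2)) ≠ 0 := by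
  intro h
  have h1 := (eval_genDisc_ne_zero_iff (monic_X_pow _) (natDegree_X_pow (2 * g + 2))
    (Pi.single ⟨g - 1, by omega⟩ 1)).mpr ?_
  · rw [h, map_zero] at h1
    exact h1 rfl
  · have e : (vGen g).map (MvPolynomial.eval (Pi.single ⟨g - 1, by omega⟩ 1)) = 1 := by
      rw [vGen, Polynomial.map_sum, Finset.sum_eq_single ⟨g - 1, by omega⟩]
      · simp
      · intro j _ hj
        simp [Pi.single_eq_of_ne hj]
      · simp
    rw [genFiber, Polynomial.map_sub, Polynomial.map_pow, Polynomial.map_pow,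
      Polynomial.map_pow, e, map_X, map_X, one_pow]
    have := separable_X_pow_sub_C (F := ℂ) (n := 2 * g + 2) 1 (Nat.cast_ne_zero.mpr (by omega))
      one_ne_zero
    rwa [map_one] at this

/-- The basis of the affine ring of a level set over `ℂ[v_2, …, v_{g+1}]`. -/
def levelBasis (hg : 1 ≤ g) :
    Module.Basis (UIndex g) (VRing g) (LevelRing g (X ^ (2 * g + 2))) :=
  Module.Basis.mk (linearIndependent_symMonomial hg (monic_X_pow _) (natDegree_X_pow _)
    (genDisc_X_pow_ne_zero hg)) span_symMonomial_eq_top.ge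

/-- The basis of the affine ring of a level set over `ℂ`. -/
def levelBasisℂ (hg : 1 ≤ g) :
    Module.Basis ((Fin g →₀ ℕ) × UIndex g) ℂ (LevelRing g (X ^ (2 * g + 2))) :=
  (MvPolynomial.basisMonomials (Fin g) ℂ).smulTower (levelBasis hg)

/-- The monomial in `v` and `u` with given exponents. -/
def monomialVU (g : ℕ) (x : (Fin g →₀ ℕ) × UIndex g) : A g :=
  vIncl g (MvPolynomial.monomial x.1 1) *
    (Multiset.map (fun i : Fin (g + 1) => (u g).coeff (g - (i : ℕ))) x.2).prod

lemma levelBasisℂ_apply (hg : 1 ≤ g) (x : (Fin g →₀ ℕ) × UIndex g) :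
    levelBasisℂ hg x = Ideal.Quotient.mk _ (monomialVU g x) := by
  rw [levelBasisℂ, Module.Basis.smulTower_apply, MvPolynomial.coe_basisMonomials, levelBasis,
    Module.Basis.mk_apply, Algebra.smul_def, algebraMap_VRing, monomialVU, map_mul, symMonomial,
    map_multiset_prod, Multiset.map_map]
  congr 3
  funext i
  rw [uRev_coeff (Nat.lt_succ_iff.mp i.2)]
  rfl

end basis

/-! ### Dimensions of the graded parts -/

section grading

variable {g : ℕ}

/-- The degree of a monomial in `v_2, …, v_{g+1}`. -/
def vWt (g : ℕ) (β : Fin g →₀ ℕ) : ℕ := Finsupp.weight (fun j : Fin g => (j : ℕ) + 2) β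

/-- The sum of a multiset of `b` elements of `{0, …, a}`. -/
def symWt {a b : ℕ} (m : Sym (Fin (a + 1)) b) : ℕ :=
  (Multiset.map (fun i : Fin (a + 1) => (i : ℕ)) m).sum

lemma u_coeff_isWeightedHomogeneous (n : ℕ) :
    MvPolynomial.IsWeightedHomogeneous (varDeg g) ((u g).coeff n) ((g : ℤ) - n) := by
  rcases lt_trichotomy n g with h | rfl | h
  · rw [u_coeff_lt h]
    convert! MvPolynomial.isWeightedHomogeneous_X ℂ (varDeg g) _ using 1
    simp only [varDeg]
    omega
  · rw [u_coeff_self, sub_self]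
    exact MvPolynomial.isWeightedHomogeneous_one _ _
  · rw [u_coeff_gt h]
    exact MvPolynomial.isWeightedHomogeneous_zero _ _ _

lemma v_coeff_isWeightedHomogeneous (n : ℕ) :
    MvPolynomial.IsWeightedHomogeneous (varDeg g) ((v g).coeff n) ((g : ℤ) + 1 - n) := by
  rcases lt_or_ge n g with h | h
  · rw [v_coeff_lt h]
    convert! MvPolynomial.isWeightedHomogeneous_X ℂ (varDeg g) _ using 1
    simp only [varDeg]
    omega
  · rw [v_coeff_ge h]
    exact MvPolynomial.isWeightedHomogeneous_zero _ _ _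

lemma w_coeff_isWeightedHomogeneous (n : ℕ) :
    MvPolynomial.IsWeightedHomogeneous (varDeg g) ((w g).coeff n) ((g : ℤ) + 2 - n) := by
  rcases lt_trichotomy n (g + 2) with h | rfl | h
  · rw [w_coeff_lt h]
    convert! MvPolynomial.isWeightedHomogeneous_X ℂ (varDeg g) _ using 1
    simp only [varDeg]
    omega
  · rw [w_coeff_self]
    convert! MvPolynomial.isWeightedHomogeneous_one ℂ (varDeg g) using 1
    push_cast
    ring
  · rw [w_coeff_gt h]
    exact MvPolynomial.isWeightedHomogeneous_zero _ _ _

lemma mul_coeff_isWeightedHomogeneous {p q : (A g)[X]} {d e : ℤ}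
    (hp : ∀ n, MvPolynomial.IsWeightedHomogeneous (varDeg g) (p.coeff n) (d - n))
    (hq : ∀ n, MvPolynomial.IsWeightedHomogeneous (varDeg g) (q.coeff n) (e - n)) (n : ℕ) :
    MvPolynomial.IsWeightedHomogeneous (varDeg g) ((p * q).coeff n) (d + e - n) := by
  rw [coeff_mul]
  refine MvPolynomial.IsWeightedHomogeneous.sum _ _ _ fun x hx => ?_
  have hx := Finset.HasAntidiagonal.mem_antidiagonal.mp hx
  convert! (hp x.1).mul (hq x.2) using 1
  omega

/-- Giving $x$ degree $1$ makes $u$, $v$, $w$ homogeneous of degrees $g$, $g+1$, $g+2$, so $uw+v^2$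
has degree $2g+2$, as does $x^{2g+2}$. The choice $f=x^{2g+2}$ is needed here. -/
lemma levelIdeal_isHomogeneous :
    letI := MvPolynomial.weightedGradedAlgebra ℂ (varDeg g)
    (levelIdeal g (X ^ (2 * g + 2))).IsHomogeneous
      (MvPolynomial.weightedHomogeneousSubmodule ℂ (varDeg g)) := by
  let := MvPolynomial.weightedGradedAlgebra ℂ (varDeg g)
  refine Ideal.homogeneous_span _ _ ?_
  rintro _ ⟨n, rfl⟩
  refine ⟨2 * g + 2 - n, ?_⟩
  simp only
  rw [MvPolynomial.mem_weightedHomogeneousSubmodule, coeff_sub, invariant, coeff_add, pow_two]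
  refine MvPolynomial.IsWeightedHomogeneous.sub (.add ?_ ?_) ?_
  · convert! mul_coeff_isWeightedHomogeneous u_coeff_isWeightedHomogeneous
      w_coeff_isWeightedHomogeneous n using 1
    ring
  · convert! mul_coeff_isWeightedHomogeneous v_coeff_isWeightedHomogeneous
      v_coeff_isWeightedHomogeneous n using 1
    ring
  · rw [Polynomial.map_pow, map_X, coeff_X_pow]
    split_ifs with h
    · convert! MvPolynomial.isWeightedHomogeneous_one ℂ (varDeg g) using 1
      rw [h]
      push_cast
      ring
    · exact MvPolynomial.isWeightedHomogeneous_zero _ _ _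

lemma monomialVU_isWeightedHomogeneous (x : (Fin g →₀ ℕ) × UIndex g) :
    MvPolynomial.IsWeightedHomogeneous (varDeg g) (monomialVU g x)
      ((vWt g x.1 : ℤ) + symWt x.2) := by
  refine MvPolynomial.IsWeightedHomogeneous.mul ?_ ?_
  · rw [vIncl, MvPolynomial.rename_monomial]
    refine MvPolynomial.isWeightedHomogeneous_monomial _ _ _ ?_
    rw [vWt, Finsupp.weight_apply, Finsupp.weight_apply, Finsupp.sum_mapDomain_index (by simp)
      (by intros; rw [add_smul]), Finsupp.sum, Finsupp.sum]
    push_cast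
    refine Finset.sum_congr rfl fun j _ => ?_
    simp [varDeg]
  · rw [symWt]
    generalize (x.2 : Multiset (Fin (g + 1))) = s
    induction s using Multiset.induction_on with
    | empty => simpa using MvPolynomial.isWeightedHomogeneous_one ℂ (varDeg g)
    | cons i s ih =>
      rw [Multiset.map_cons, Multiset.map_cons, Multiset.prod_cons, Multiset.sum_cons,
        Nat.cast_add]
      refine MvPolynomial.IsWeightedHomogeneous.mul ?_ ih
      convert! u_coeff_isWeightedHomogeneous (g - (i : ℕ)) using 1
      have := i.2
      omega

/-- The basis consists of classes of homogeneous polynomials and the ideal is homogeneous, so in the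
expansion of a homogeneous class the terms of other degrees can be discarded. -/
lemma ringPart_eq_span (hg : 1 ≤ g) (n : ℤ) : ringPart g n =
    Submodule.span ℂ (levelBasisℂ hg '' {x | (vWt g x.1 : ℤ) + symWt x.2 = n}) := by
  apply le_antisymm
  · rintro _ ⟨p, hp, rfl⟩
    rw [AlgHom.toLinearMap_apply, Ideal.Quotient.mkₐ_eq_mk]
    set c := (levelBasisℂ hg).repr (Ideal.Quotient.mk _ p) with hc
    set P : A g := c.sum fun x z => z • monomialVU g x with hP
    have h1 : Ideal.Quotient.mk (levelIdeal g (X ^ (2 * g + 2))) P = Ideal.Quotient.mk _ p := by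
      conv_rhs => rw [← (levelBasisℂ hg).linearCombination_repr (Ideal.Quotient.mk _ p), ← hc,
        Finsupp.linearCombination_apply]
      rw [hP, Finsupp.sum, Finsupp.sum, map_sum]
      refine Finset.sum_congr rfl fun x _ => ?_
      rw [levelBasisℂ_apply]
      rfl
    -- $P-p$ lies in the homogeneous ideal, hence so does its component of degree $n$, which is that
    -- of $P$ minus $p$.
    have h2 := MvPolynomial.weightedHomogeneousComponent_mem_of_mem ℂ (varDeg g)
      levelIdeal_isHomogeneous ((Ideal.Quotient.mk_eq_mk_iff_sub_mem _ _).mp h1) n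
    rw [map_sub, MvPolynomial.weightedHomogeneousComponent_eq_self hp,
      ← Ideal.Quotient.mk_eq_mk_iff_sub_mem] at h2
    rw [← h2, hP, Finsupp.sum, map_sum, map_sum]
    refine Submodule.sum_mem _ fun x _ => ?_
    rw [map_smul, MvPolynomial.weightedHomogeneousComponent_of_mem
      (monomialVU_isWeightedHomogeneous x)]
    split_ifs with hx
    · change c x • Ideal.Quotient.mk _ (monomialVU g x) ∈ _
      rw [← levelBasisℂ_apply hg]
      exact Submodule.smul_mem _ _ (Submodule.subset_span ⟨x, hx.symm, rfl⟩)
    · rw [smul_zero, map_zero]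
      exact zero_mem _
  · refine Submodule.span_le.mpr ?_
    rintro _ ⟨x, rfl, rfl⟩
    exact ⟨monomialVU g x, monomialVU_isWeightedHomogeneous x, (levelBasisℂ_apply hg x).symm⟩

/-- The sum `i_1 + ⋯ + i_k` of the indices of `dt_{i_1} ∧ ⋯ ∧ dt_{i_k}`. -/
def setWt {g : ℕ} (s : Finset (Fin g)) : ℕ := ∑ i ∈ s, ((i : ℕ) + 1)

/-- The basis of the `k`-th exterior power of `ℂ^g`. -/
def extBasis (g k : ℕ) : Module.Basis (Set.powersetCard (Fin g) k) ℂ (⋀[ℂ]^k (Fin g → ℂ)) :=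
  (Pi.basisFun ℂ (Fin g)).exteriorPower k

lemma extBasis_apply (k : ℕ) (t : Set.powersetCard (Fin g) k) : extBasis g k t =
    exteriorPower.ιMulti ℂ k fun l => dt g (Set.powersetCard.ofFinEmbEquiv.symm t l) := by
  rw [extBasis, exteriorPower.basis_apply, exteriorPower.ιMulti_family]
  congr 1
  funext l
  simp [dt, Pi.basisFun_apply]

lemma setWt_coe {k : ℕ} (t : Set.powersetCard (Fin g) k) :
    setWt (t : Finset (Fin g)) =
      ∑ l, ((Set.powersetCard.ofFinEmbEquiv.symm t l : ℕ) + 1) := by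
  obtain ⟨e, rfl⟩ := Set.powersetCard.ofFinEmbEquiv.surjective t
  rw [Equiv.symm_apply_apply, Set.powersetCard.ofFinEmbEquiv_apply, setWt,
    Set.powersetCard.val_ofFinEmb, Finset.sum_map]
  rfl

/-- Sorting the indices changes the wedge product by a sign and leaves their sum unchanged; a
repeated index gives zero. -/
lemma ιMulti_dt_mem (k : ℕ) (s : Fin k → Fin g) :
    exteriorPower.ιMulti ℂ k (fun l => dt g (s l)) ∈ Submodule.span ℂ
      (extBasis g k '' {t | setWt (t : Finset (Fin g)) = ∑ l, ((s l : ℕ) + 1)}) := by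
  by_cases hs : Function.Injective s
  · set σ := Tuple.sort s
    have hmono : StrictMono (s ∘ σ) :=
      (Tuple.monotone_sort s).strictMono_of_injective (hs.comp σ.injective)
    set t := Set.powersetCard.ofFinEmbEquiv (OrderEmbedding.ofStrictMono (s ∘ σ) hmono) with ht
    have e1 : extBasis g k t = exteriorPower.ιMulti ℂ k ((fun l => dt g (s l)) ∘ σ) := by
      rw [extBasis_apply, ht, Equiv.symm_apply_apply]
      rfl
    have e2 : t ∈ {t : Set.powersetCard (Fin g) k |
        setWt (t : Finset (Fin g)) = ∑ l, ((s l : ℕ) + 1)} := by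
      rw [Set.mem_ofPred_eq]
      rw [setWt_coe, ht, Equiv.symm_apply_apply]
      exact Equiv.sum_comp σ fun l => ((s l : ℕ) + 1)
    have e3 := (exteriorPower.ιMulti ℂ k).map_perm (fun l => dt g (s l)) σ
    have h : exteriorPower.ιMulti ℂ k (fun l => dt g (s l)) =
        Equiv.Perm.sign σ • extBasis g k t := by
      rw [e1, e3, smul_smul, Int.units_mul_self, one_smul]
    have hmem := Submodule.subset_span (R := ℂ) (Set.mem_image_of_mem (extBasis g k) e2)
    rw [h]
    rcases Int.units_eq_one_or (Equiv.Perm.sign σ) with h1 | h1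
    · rw [h1, one_smul]
      exact hmem
    · rw [h1, Units.neg_smul, one_smul]
      exact Submodule.neg_mem _ hmem
  · rw [AlternatingMap.map_eq_zero_of_not_injective]
    · exact zero_mem _
    · exact fun h => hs (h.of_comp (f := dt g))

/-- The index set of the basis of `C_0^k`. -/
abbrev CIndex (g k : ℕ) : Type := ((Fin g →₀ ℕ) × UIndex g) × Set.powersetCard (Fin g) k

/-- The degree of an element of the basis of `C_0^k`. -/
def cWt {g k : ℕ} (y : CIndex g k) : ℤ :=
  (vWt g y.1.1 : ℤ) + symWt y.1.2 - setWt (y.2 : Finset (Fin g))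

/-- A homogeneous basis of `C_0^k`. -/
def cochainBasis (hg : 1 ≤ g) (k : ℕ) :
    Module.Basis (CIndex g k) ℂ (Cochains g (X ^ (2 * g + 2)) k) :=
  (levelBasisℂ hg).tensorProduct (extBasis g k)

lemma tmul_mem_span {ι κ M N : Type*} [AddCommGroup M] [Module ℂ M] [AddCommGroup N] [Module ℂ N]
    {b : ι → M} {c : κ → N} {s : Set ι} {t : Set κ} {r : Set (ι × κ)}
    (h : ∀ i ∈ s, ∀ j ∈ t, (i, j) ∈ r) {x : M} {y : N} (hx : x ∈ Submodule.span ℂ (b '' s))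
    (hy : y ∈ Submodule.span ℂ (c '' t)) :
    x ⊗ₜ[ℂ] y ∈ Submodule.span ℂ ((fun z : ι × κ => b z.1 ⊗ₜ[ℂ] c z.2) '' r) := by
  induction hx using Submodule.span_induction with
  | mem x hx =>
    obtain ⟨i, hi, rfl⟩ := hx
    induction hy using Submodule.span_induction with
    | mem y hy =>
      obtain ⟨j, hj, rfl⟩ := hy
      exact Submodule.subset_span ⟨(i, j), h i hi j hj, rfl⟩
    | zero => simp
    | add y z _ _ hy hz => rw [tmul_add]; exact add_mem hy hz
    | smul a y _ hy => rw [tmul_smul]; exact Submodule.smul_mem _ _ hy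
  | zero => simp
  | add x z _ _ hx hz => rw [add_tmul]; exact add_mem hx hz
  | smul a x _ hx => rw [← smul_tmul']; exact Submodule.smul_mem _ _ hx

/-- The degree-`n` part of `C_0^k`, as a submodule of the tensor product. -/
def cochainPart (g k : ℕ) (n : ℤ) : Submodule ℂ (Cochains g (X ^ (2 * g + 2)) k) :=
  Submodule.span ℂ {c | ∃ (m : ℤ) (a : LevelRing g (X ^ (2 * g + 2))) (s : Fin k → Fin g),
    a ∈ ringPart g m ∧ m - ∑ l, (((s l : ℕ) : ℤ) + 1) = n ∧
      c = a ⊗ₜ[ℂ] exteriorPower.ιMulti ℂ k (fun l => dt g (s l))}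

lemma cochainPart_eq_span (hg : 1 ≤ g) (k : ℕ) (n : ℤ) : cochainPart g k n =
    Submodule.span ℂ (cochainBasis hg k '' {y | cWt y = n}) := by
  have hb : ⇑(cochainBasis hg k) = fun z => levelBasisℂ hg z.1 ⊗ₜ[ℂ] extBasis g k z.2 := by
    funext z
    rw [cochainBasis, Module.Basis.tensorProduct_apply']
  apply le_antisymm
  · refine Submodule.span_le.mpr ?_
    rintro _ ⟨m, a, s, ha, hm, rfl⟩
    rw [ringPart_eq_span hg] at ha
    rw [hb]
    refine tmul_mem_span (fun x hx t ht => ?_) ha (ιMulti_dt_mem k s)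
    simp only [Set.mem_ofPred_eq] at hx ht ⊢
    rw [cWt, hx, ht, ← hm]
    push_cast
    rfl
  · refine Submodule.span_le.mpr ?_
    rintro _ ⟨y, rfl, rfl⟩
    refine Submodule.subset_span ⟨(vWt g y.1.1 : ℤ) + symWt y.1.2, levelBasisℂ hg y.1,
      Set.powersetCard.ofFinEmbEquiv.symm y.2, ?_, ?_, ?_⟩
    · rw [ringPart_eq_span hg]
      exact Submodule.subset_span ⟨y.1, rfl, rfl⟩
    · rw [cWt, setWt_coe]
      push_cast
      rfl
    · simp only [hb, extBasis_apply]

/-- Every $v_j$ has positive degree. The other two indices of the basis of $C_0^k$ range over finite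
sets, so this yields the finiteness of the graded parts. -/
lemma finite_vWt (n : ℤ) : {β : Fin g →₀ ℕ | (vWt g β : ℤ) = n}.Finite := by
  refine (Finsupp.finite_of_nat_weight_eq (fun j : Fin g => (j : ℕ) + 2) (by simp)
    n.toNat).subset fun β hβ => ?_
  simp only [Set.mem_ofPred_eq, vWt] at hβ ⊢
  omega

/-- The coordinates `(m, s)` and `β` of the basis elements of degree `n`. -/
def cWtEquiv (g k : ℕ) (n : ℤ) : {y : CIndex g k // cWt y = n} ≃
    Σ p : UIndex g × Set.powersetCard (Fin g) k,
      {β : Fin g →₀ ℕ // (vWt g β : ℤ) = n - symWt p.1 + setWt (p.2 : Finset (Fin g))} where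
  toFun y := ⟨(y.1.1.2, y.1.2), y.1.1.1, by have := y.2; rw [cWt] at this; simp only; omega⟩
  invFun z := ⟨((z.2.1, z.1.1), z.1.2), by have := z.2.2; rw [cWt]; simp only at this ⊢; omega⟩
  left_inv _ := rfl
  right_inv _ := rfl

/-- The number of monomials of degree `n` in `v_2, …, v_{g+1}`. -/
def vCount (g : ℕ) (n : ℤ) : ℕ := Nat.card {β : Fin g →₀ ℕ // (vWt g β : ℤ) = n}

instance instFiniteVWt (n : ℤ) : Finite {β : Fin g →₀ ℕ // (vWt g β : ℤ) = n} :=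
  (finite_vWt n).to_subtype

instance instFiniteCWt (k : ℕ) (n : ℤ) : Finite {y : CIndex g k // cWt y = n} :=
  Finite.of_equiv _ (cWtEquiv g k n).symm

theorem finite_gradedPart (hg : 1 ≤ g) (k : ℕ) (n : ℤ) : Module.Finite ℂ (gradedPart g k n) := by
  change Module.Finite ℂ (cochainPart g k n)
  rw [cochainPart_eq_span hg]
  have : Finite {y : CIndex g k | cWt y = n} := instFiniteCWt k n
  exact Module.Finite.span_of_finite ℂ ((Set.toFinite _).image _)

/-- The dimension is the number of homogeneous basis elements of degree $n$, grouped by their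
$u$-monomial and their wedge of $dt$'s. -/
theorem finrank_gradedPart (hg : 1 ≤ g) (k : ℕ) (n : ℤ) :
    Module.finrank ℂ (gradedPart g k n) = ∑ t : Set.powersetCard (Fin g) k, ∑ m : UIndex g,
      vCount g (n - symWt m + setWt (t : Finset (Fin g))) := by
  have := Fintype.ofFinite {y : CIndex g k // cWt y = n}
  have h1 : cochainBasis hg k '' {y | cWt y = n} =
      Set.range fun y : {y : CIndex g k // cWt y = n} => cochainBasis hg k y := by
    rw [Set.image_eq_range]
    rfl
  change Module.finrank ℂ (cochainPart g k n) = _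
  rw [cochainPart_eq_span hg, h1]
  refine (finrank_span_eq_card
    ((cochainBasis hg k).linearIndependent.comp _ Subtype.val_injective)).trans ?_
  rw [← Nat.card_eq_fintype_card, Nat.card_congr (cWtEquiv g k n), Nat.card_sigma,
    Fintype.sum_prod_type, Finset.sum_comm]
  rfl

end grading

/-! ### Generating functions -/

section generating

variable {K : Type*} [Field K]

/-- The generating function of multisets of `b` elements of `{0, …, a}` by their sum. -/
def symGen (q : K) (a b : ℕ) : K := ∑ m : Sym (Fin (a + 1)) b, q ^ symWt m

lemma symWt_cons {a b : ℕ} (m : Sym (Fin (a + 1)) b) : symWt (Sym.cons 0 m) = symWt m := by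
  rw [symWt, symWt, Sym.coe_cons, Multiset.map_cons, Multiset.sum_cons, Fin.val_zero, zero_add]

lemma symWt_map_succ {a b : ℕ} (m : Sym (Fin (a + 1)) b) :
    symWt (Sym.map (Fin.succAbove 0) m : Sym (Fin (a + 1 + 1)) b) = b + symWt m := by
  rw [symWt, symWt, Sym.coe_map, Multiset.map_map]
  have e : ((fun i : Fin (a + 1 + 1) => (i : ℕ)) ∘ Fin.succAbove 0) =
      fun i : Fin (a + 1) => (i : ℕ) + 1 := by
    funext i
    simp
  rw [e, Multiset.sum_map_add, add_comm]
  simp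

/-- The $q$-Pascal rule: a multiset containing $0$ loses one copy of it at no cost; otherwise all
$b+1$ elements are lowered by one, which accounts for $q^{b+1}$. -/
lemma symGen_succ_succ (q : K) (a b : ℕ) :
    symGen q (a + 1) (b + 1) = symGen q (a + 1) b + q ^ (b + 1) * symGen q a (b + 1) := by
  classical
  rw [symGen, ← Equiv.sum_comp ((Sym.e1.symm.sumCongr Sym.e2.symm).trans
    (Equiv.sumCompl fun s : Sym (Fin (a + 2)) (b + 1) => (0 : Fin (a + 2)) ∈ s)),
    Fintype.sum_sum_type, symGen, symGen, Finset.mul_sum]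
  congr 1
  · exact Finset.sum_congr rfl fun m _ => congrArg (q ^ ·) (symWt_cons m)
  · refine Finset.sum_congr rfl fun m _ => ?_
    rw [← pow_add]
    exact congrArg (q ^ ·) (symWt_map_succ m)

lemma symGen_zero_left (q : K) (b : ℕ) : symGen q 0 b = 1 := by
  have h : ∀ m : Sym (Fin (0 + 1)) b, symWt m = 0 := fun m => by
    simp [symWt]
  simp only [symGen, h, pow_zero]
  simp

lemma symGen_zero_right (q : K) (a : ℕ) : symGen q a 0 = 1 := by
  have h : ∀ m : Sym (Fin (a + 1)) 0, symWt m = 0 := fun m => by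
    rw [Sym.eq_nil_of_card_zero m]
    rfl
  simp [symGen, h]

lemma qFact_succ (q : K) (n : ℕ) : qFact q (n + 1) = qFact q n * (1 - q ^ (n + 1)) := by
  rw [qFact, Finset.prod_Icc_succ_top (by omega)]
  rfl

lemma qFact_zero (q : K) : qFact q 0 = 1 := by simp [qFact]

/-- `symGen` is the Gaussian binomial coefficient. Without denominators the identity holds for every
$q$, roots of unity included. -/
theorem symGen_mul (q : K) (a b : ℕ) :
    symGen q a b * qFact q a * qFact q b = qFact q (a + b) := by
  induction a generalizing b with
  | zero => rw [symGen_zero_left, qFact_zero, one_mul, one_mul, zero_add]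
  | succ a iha =>
    induction b with
    | zero => rw [symGen_zero_right, qFact_zero, one_mul, mul_one, add_zero]
    | succ b ihb =>
      have h := iha (b + 1)
      rw [show a + (b + 1) = a + 1 + b by ring] at h
      rw [show a + 1 + (b + 1) = a + 1 + b + 1 by ring, qFact_succ q (a + 1 + b), symGen_succ_succ, qFact_succ q b]
      rw [qFact_succ q b] at h
      rw [qFact_succ q a] at ihb ⊢
      -- This rests on $[a+b+2]_q=[b+1]_q+q^{b+1}[a+1]_q$.
      linear_combination (1 - q ^ (b + 1)) * ihb + q ^ (b + 1) * (1 - q ^ (a + 1)) * h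

lemma qFact_ne_zero {q : K} {n : ℕ} (hq : ∀ i ∈ Finset.Icc 1 n, q ^ i ≠ 1) : qFact q n ≠ 0 :=
  Finset.prod_ne_zero_iff.mpr fun i hi => sub_ne_zero.mpr (hq i hi).symm

lemma prod_range_one_sub (q : K) (n : ℕ) : ∏ i : Fin n, (1 - q ^ ((i : ℕ) + 1)) = qFact q n := by
  induction n with
  | zero => simp [qFact_zero]
  | succ n ih => rw [Fin.prod_univ_castSucc, qFact_succ]; simpa using Or.inl ih

/-- The degrees of the $v_j$ start at $2$, so the factor $[1]_q$ is missing from $[g+1]_q!$; this is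
the origin of $[1]_q$ in the final formula. -/
lemma prod_range_one_sub_two (q : K) (n : ℕ) :
    qInt q 1 * ∏ i : Fin n, (1 - q ^ ((i : ℕ) + 2)) = qFact q (n + 1) := by
  rw [← prod_range_one_sub, Fin.prod_univ_succ, qInt]
  simp [add_assoc]

lemma sum_fin_succ (n : ℕ) : ∑ i : Fin n, ((i : ℕ) + 1) = n * (n + 1) / 2 := by
  rw [Fin.sum_univ_eq_sum_range (fun i => i + 1) n]
  have h := Finset.sum_range_id (n + 1)
  rw [Finset.sum_range_succ', add_zero, Nat.add_sub_cancel, mul_comm] at h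
  exact h

/-- The left side is the expansion of $\prod_{i=1}^g(1-q^{-i})$ over subsets; then
$1-q^{-i}=-q^{-i}(1-q^i)$ is used in each factor. -/
lemma sum_powersetCard {q : K} (hq : q ≠ 0) (g : ℕ) :
    ∑ k ∈ Finset.range (g + 1), (-1) ^ k * ∑ t : Set.powersetCard (Fin g) k,
      q ^ (-(setWt (t : Finset (Fin g)) : ℤ)) =
    (-1) ^ g * q ^ (-((g * (g + 1) / 2 : ℕ) : ℤ)) * qFact q g := by
  simp only [zpow_neg, zpow_natCast, ← inv_pow]
  have h1 : ∀ k, (-1 : K) ^ k * ∑ t : Set.powersetCard (Fin g) k,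
      q⁻¹ ^ setWt (t : Finset (Fin g)) =
      ∑ t ∈ Finset.powersetCard k (Finset.univ : Finset (Fin g)),
        ∏ i ∈ t, -q⁻¹ ^ ((i : ℕ) + 1) := by
    intro k
    rw [Finset.mul_sum, ← Finset.sum_coe_sort (Finset.powersetCard k Finset.univ)]
    refine Fintype.sum_equiv (Equiv.subtypeEquivRight fun t => ?_) _ _ fun t => ?_
    · simp
    · have hc : (t : Finset (Fin g)).card = k := t.2
      simp only [Equiv.subtypeEquivRight_apply_coe]
      rw [Finset.prod_neg, hc, setWt, Finset.prod_pow_eq_pow_sum]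
  have h2 := Finset.sum_powerset (Finset.univ : Finset (Fin g))
    fun t => ∏ i ∈ t, -q⁻¹ ^ ((i : ℕ) + 1)
  rw [Finset.card_univ, Fintype.card_fin] at h2
  simp only [h1]
  rw [← h2, ← Finset.prod_one_add, ← prod_range_one_sub, ← sum_fin_succ]
  have h3 : ∀ i : Fin g, 1 + -q⁻¹ ^ ((i : ℕ) + 1) =
      -q⁻¹ ^ ((i : ℕ) + 1) * (1 - q ^ ((i : ℕ) + 1)) := fun i => by
    rw [mul_sub, neg_mul, neg_mul, ← mul_pow, inv_mul_cancel₀ hq, one_pow]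
    ring
  simp only [h3]
  rw [Finset.prod_mul_distrib, Finset.prod_neg, Finset.card_univ, Fintype.card_fin,
    Finset.prod_pow_eq_pow_sum]

/-- The Euler characteristic as a sum over the homogeneous bases, where `P` stands for the
generating function of the monomials in `v`. -/
theorem sum_eq_eulerFormula {q P : K} {g : ℕ} (hq : q ≠ 0)
    (hq1 : ∀ i ∈ Finset.Icc 1 (g + 2), q ^ i ≠ 1)
    (hP : P * ∏ j : Fin g, (1 - q ^ ((j : ℕ) + 2)) = 1) :
    ∑ k ∈ Finset.range (g + 1), (-1) ^ k * ∑ t : Set.powersetCard (Fin g) k, ∑ m : UIndex g,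
      q ^ ((symWt m : ℤ) - setWt (t : Finset (Fin g))) * P = eulerFormula q g := by
  have h1 : ∀ k, ∑ t : Set.powersetCard (Fin g) k, ∑ m : UIndex g,
      q ^ ((symWt m : ℤ) - setWt (t : Finset (Fin g))) * P =
      (∑ t : Set.powersetCard (Fin g) k, q ^ (-(setWt (t : Finset (Fin g)) : ℤ))) *
        (symGen q g (g + 2) * P) := fun k => by
    rw [Finset.sum_mul]
    refine Finset.sum_congr rfl fun t _ => ?_
    rw [symGen, ← Finset.sum_mul, ← mul_assoc, Finset.mul_sum]
    congr 1
    refine Finset.sum_congr rfl fun m _ => ?_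
    rw [sub_eq_neg_add, zpow_add₀ hq, zpow_natCast]
  simp only [h1, ← mul_assoc]
  rw [← Finset.sum_mul, ← Finset.sum_mul, sum_powersetCard hq, eulerFormula]
  have hG := symGen_mul q g (g + 2)
  rw [show g + (g + 2) = 2 * g + 2 by ring] at hG
  have hP2 : P * qFact q (g + 1) = qInt q 1 := by
    rw [← prod_range_one_sub_two]
    linear_combination qInt q 1 * hP
  have n1 : qFact q (g + 1) ≠ 0 := qFact_ne_zero fun i hi => hq1 i (by
    rw [Finset.mem_Icc] at hi ⊢; omega)
  have n2 : qFact q (g + 2) ≠ 0 := qFact_ne_zero hq1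
  rw [mul_assoc (_ * _), mul_assoc (_ * _)]
  congr 1
  rw [eq_div_iff (mul_ne_zero n1 n2)]
  linear_combination symGen q g (g + 2) * qFact q g * qFact q (g + 2) * hP2 + qInt q 1 * hG

end generating

/-! ### The Euler characteristic as a Laurent series -/

section laurent

variable {g : ℕ}

/-- The power series `1 / (1 - q^d)`. -/
def geomSeries (d : ℕ) : PowerSeries ℚ := PowerSeries.mk fun n => if d ∣ n then 1 else 0

lemma geomSeries_mul {d : ℕ} (hd : 0 < d) : geomSeries d * (1 - PowerSeries.X ^ d) = 1 := by
  ext n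
  rw [mul_sub, mul_one, map_sub, PowerSeries.coeff_mul_X_pow', geomSeries, PowerSeries.coeff_mk,
    PowerSeries.coeff_mk, PowerSeries.coeff_one]
  rcases Nat.eq_zero_or_pos n with rfl | hn
  · simp [hd.ne']
  · rw [if_neg hn.ne']
    rcases le_or_gt d n with h | h
    · obtain ⟨k, rfl⟩ := Nat.exists_eq_add_of_le h
      simp
    · simp [Nat.not_dvd_of_pos_of_lt hn h, not_le.mpr h]

/-- The generating function of the monomials in `v_2, …, v_{g+1}` by their degree. -/
def vSeries (g : ℕ) : PowerSeries ℚ := ∏ j : Fin g, geomSeries ((j : ℕ) + 2)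

lemma vSeries_mul : vSeries g * ∏ j : Fin g, (1 - PowerSeries.X ^ ((j : ℕ) + 2)) = 1 := by
  rw [vSeries, ← Finset.prod_mul_distrib]
  exact Finset.prod_eq_one fun j _ => geomSeries_mul (by omega)

/-- The coefficient of the product counts the tuples $(l_j)$ with sum $n$ and $(j+2)\mid l_j$;
dividing $l_j$ by $j+2$ gives the exponents of a monomial. -/
lemma coeff_vSeries (n : ℕ) : PowerSeries.coeff n (vSeries g) = vCount g n := by
  classical
  rw [vSeries, PowerSeries.coeff_prod]
  simp only [geomSeries, PowerSeries.coeff_mk, Finset.prod_ite_zero, Finset.prod_const_one,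
    Finset.sum_boole]
  rw [vCount, ← Fintype.card_coe, ← Nat.card_eq_fintype_card]
  congr 1
  refine Nat.card_congr
    { toFun := fun l => ⟨Finsupp.equivFunOnFinite.symm fun j => l.1 j / ((j : ℕ) + 2), ?_⟩
      invFun := fun β => ⟨Finsupp.equivFunOnFinite.symm fun j => β.1 j * ((j : ℕ) + 2), ?_⟩
      left_inv := ?_
      right_inv := ?_ }
  · obtain ⟨l, hl⟩ := l
    rw [Finset.mem_filter, Finset.mem_finsuppAntidiag] at hl
    rw [vWt, Finsupp.weight_eq_sum]
    refine (congrArg Nat.cast ?_).trans (congrArg Nat.cast hl.1.1)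
    exact Finset.sum_congr rfl fun j _ => Nat.div_mul_cancel (hl.2 j (Finset.mem_univ j))
  · obtain ⟨β, hβ⟩ := β
    rw [Finset.mem_filter, Finset.mem_finsuppAntidiag]
    rw [vWt, Finsupp.weight_eq_sum] at hβ
    refine ⟨⟨?_, Finset.subset_univ _⟩, fun j _ => ?_⟩
    · simpa using Int.ofNat_inj.mp hβ
    · simp
  · rintro ⟨l, hl⟩
    rw [Finset.mem_filter] at hl
    ext j
    simpa using Nat.div_mul_cancel (hl.2 j (Finset.mem_univ j))
  · rintro ⟨β, hβ⟩
    ext j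
    simp

lemma vCount_neg {n : ℤ} (hn : n < 0) : vCount g n = 0 := by
  have : IsEmpty {β : Fin g →₀ ℕ // (vWt g β : ℤ) = n} := ⟨fun β => by have := β.2; omega⟩
  exact Nat.card_of_isEmpty

lemma coeff_vSeries_coe (n : ℤ) : (vSeries g : LaurentSeries ℚ).coeff n = vCount g n := by
  rw [PowerSeries.coeff_coe]
  split_ifs with h
  · rw [vCount_neg h, Nat.cast_zero]
  · rw [coeff_vSeries, Int.natAbs_of_nonneg (not_lt.mp h)]

lemma ch_coeff (hg : 1 ≤ g) (k : ℕ) (n : ℤ) : (ch g k).coeff n =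
    ∑ t : Set.powersetCard (Fin g) k, ∑ m : UIndex g,
      (vCount g (n - (symWt m - setWt (t : Finset (Fin g)))) : ℚ) := by
  change (Module.finrank ℂ (gradedPart g k n) : ℚ) = _
  rw [finrank_gradedPart hg]
  push_cast
  simp only [sub_sub_eq_add_sub, sub_add_eq_add_sub]

lemma ch_eq (hg : 1 ≤ g) (k : ℕ) : ch g k =
    ∑ t : Set.powersetCard (Fin g) k, ∑ m : UIndex g,
      (HahnSeries.single (1 : ℤ) (1 : ℚ) : LaurentSeries ℚ) ^
        ((symWt m : ℤ) - setWt (t : Finset (Fin g))) * (vSeries g : LaurentSeries ℚ) := by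
  ext n
  rw [ch_coeff hg]
  simp only [HahnSeries.coeff_sum, ← RatFunc.single_zpow, HahnSeries.coeff_single_mul,
    coeff_vSeries_coe, one_mul]

theorem qEulerChar_eq (hg : 1 ≤ g) : qEulerChar g =
    eulerFormula (HahnSeries.single (1 : ℤ) (1 : ℚ) : LaurentSeries ℚ) g := by
  have hX : (HahnSeries.single (1 : ℤ) (1 : ℚ) : LaurentSeries ℚ) = (PowerSeries.X : PowerSeries ℚ) :=
    (PowerSeries.coe_X).symm
  rw [qEulerChar, ← sum_eq_eulerFormula (P := (vSeries g : LaurentSeries ℚ))]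
  · exact Finset.sum_congr rfl fun k _ => by rw [ch_eq hg]
  · simp
  -- For $i\ge1$ the series $q^i$ has constant coefficient $0$, so it is not $1$.
  · intro i hi h
    have := congrArg (fun f => HahnSeries.coeff f 0) h
    rw [Finset.mem_Icc] at hi
    simp only [HahnSeries.single_pow, HahnSeries.coeff_one] at this
    rw [HahnSeries.coeff_single_of_ne (by simp; omega)] at this
    simp at this
  · have h := congrArg (HahnSeries.ofPowerSeries ℤ ℚ) (vSeries_mul (g := g))
    rw [map_mul, map_prod, map_one] at h
    refine Eq.trans ?_ h
    rw [hX]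
    congr 1
    refine Finset.prod_congr rfl fun j _ => ?_
    rw [map_sub, map_one, map_pow]

end laurent

/-! ### Convergence -/

section convergence

/-- The power series `f` converges absolutely at `q`, with sum `s`. -/
def HasEval (f : PowerSeries ℚ) (q s : ℂ) : Prop :=
  Summable (fun n => ‖((PowerSeries.coeff n f : ℚ) : ℂ) * q ^ n‖) ∧
    ∑' n, ((PowerSeries.coeff n f : ℚ) : ℂ) * q ^ n = s

lemma HasEval.one (q : ℂ) : HasEval 1 q 1 := by
  have h : HasSum (fun n => ((PowerSeries.coeff n (1 : PowerSeries ℚ) : ℚ) : ℂ) * q ^ n) 1 := by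
    convert hasSum_single 0 fun n hn => ?_ using 1
    · simp
    · simp [PowerSeries.coeff_one, hn]
  exact ⟨h.summable.norm, h.tsum_eq⟩

/-- The Cauchy product, for which absolute convergence is built into `HasEval`. -/
lemma HasEval.mul {f₁ f₂ : PowerSeries ℚ} {q s₁ s₂ : ℂ} (h₁ : HasEval f₁ q s₁)
    (h₂ : HasEval f₂ q s₂) : HasEval (f₁ * f₂) q (s₁ * s₂) := by
  have e : ∀ n, ((PowerSeries.coeff n (f₁ * f₂) : ℚ) : ℂ) * q ^ n =
      ∑ x ∈ Finset.HasAntidiagonal.antidiagonal n, (((PowerSeries.coeff x.1 f₁ : ℚ) : ℂ) * q ^ x.1) *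
        (((PowerSeries.coeff x.2 f₂ : ℚ) : ℂ) * q ^ x.2) := by
    intro n
    rw [PowerSeries.coeff_mul]
    push_cast
    rw [Finset.sum_mul]
    refine Finset.sum_congr rfl fun x hx => ?_
    rw [← Finset.HasAntidiagonal.mem_antidiagonal.mp hx, pow_add]
    ring
  have h := summable_norm_sum_mul_antidiagonal_of_summable_norm h₁.1 h₂.1
  have h' := tsum_mul_tsum_eq_tsum_sum_antidiagonal_of_summable_norm h₁.1 h₂.1
  rw [h₁.2, h₂.2] at h'
  simp only [← e] at h h'
  exact ⟨h, h'.symm⟩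

lemma HasEval.prod {ι : Type*} (t : Finset ι) {f : ι → PowerSeries ℚ} {q : ℂ} {s : ι → ℂ}
    (h : ∀ i ∈ t, HasEval (f i) q (s i)) : HasEval (∏ i ∈ t, f i) q (∏ i ∈ t, s i) := by
  classical
  induction t using Finset.induction_on with
  | empty => exact HasEval.one q
  | insert i t hi ih =>
    rw [Finset.prod_insert hi, Finset.prod_insert hi]
    exact (h i (Finset.mem_insert_self i t)).mul
      (ih fun j hj => h j (Finset.mem_insert_of_mem hj))

lemma pow_norm_lt_one {q : ℂ} (hq : ‖q‖ < 1) {d : ℕ} (hd : 0 < d) : ‖q ^ d‖ < 1 := by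
  rw [norm_pow]
  exact pow_lt_one₀ (norm_nonneg q) hq hd.ne'

lemma hasEval_geomSeries {q : ℂ} (hq : ‖q‖ < 1) {d : ℕ} (hd : 0 < d) :
    HasEval (geomSeries d) q (1 - q ^ d)⁻¹ := by
  have h : HasSum (fun n => ((PowerSeries.coeff n (geomSeries d) : ℚ) : ℂ) * q ^ n)
      (1 - q ^ d)⁻¹ := by
    -- Only the multiples of $d$ contribute, which leaves the geometric series in $q^d$.
    rw [← (mul_right_injective₀ hd.ne').hasSum_iff (f := fun n =>
      ((PowerSeries.coeff n (geomSeries d) : ℚ) : ℂ) * q ^ n)]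
    · have e : (fun n => ((PowerSeries.coeff n (geomSeries d) : ℚ) : ℂ) * q ^ n) ∘ (d * ·) =
          fun n => (q ^ d) ^ n := by
        funext n
        simp [geomSeries, pow_mul]
      rw [e]
      exact hasSum_geometric_of_norm_lt_one (pow_norm_lt_one hq hd)
    · intro n hn
      rw [geomSeries, PowerSeries.coeff_mk, if_neg, Rat.cast_zero, zero_mul]
      rintro ⟨k, rfl⟩
      exact hn ⟨k, rfl⟩
  exact ⟨h.summable.norm, h.tsum_eq⟩

variable {g : ℕ}

lemma hasSum_vCount {q : ℂ} (hq : ‖q‖ < 1) :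
    HasSum (fun n : ℤ => (vCount g n : ℂ) * q ^ n) (∏ j : Fin g, (1 - q ^ ((j : ℕ) + 2))⁻¹) := by
  have h := HasEval.prod (Finset.univ : Finset (Fin g)) fun j _ =>
    hasEval_geomSeries hq (d := (j : ℕ) + 2) (by omega)
  rw [← (Nat.cast_injective (R := ℤ)).hasSum_iff]
  · have h2 := h.1.of_norm.hasSum
    rw [h.2] at h2
    refine (congrArg (HasSum · _) (funext fun n => ?_)).mp h2
    have := coeff_vSeries (g := g) n
    rw [vSeries] at this
    rw [this]
    simp
  · intro n hn
    rw [vCount_neg, Nat.cast_zero, zero_mul]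
    by_contra hc
    exact hn ⟨n.toNat, by omega⟩

lemma hasSum_vCount_sub {q : ℂ} (hq0 : q ≠ 0) (hq : ‖q‖ < 1) (a : ℤ) :
    HasSum (fun n : ℤ => (vCount g (n - a) : ℂ) * q ^ n)
      (q ^ a * ∏ j : Fin g, (1 - q ^ ((j : ℕ) + 2))⁻¹) := by
  rw [← (Equiv.addRight a).hasSum_iff]
  refine (congrArg (HasSum · _) (funext fun n => ?_)).mp
    ((hasSum_vCount (g := g) hq).mul_left (q ^ a))
  simp only [Function.comp_apply, Equiv.coe_addRight, add_sub_cancel_right]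
  rw [zpow_add₀ hq0]
  ring

lemma qEulerChar_coeff (hg : 1 ≤ g) (n : ℤ) : (qEulerChar g).coeff n =
    ∑ k ∈ Finset.range (g + 1), (-1) ^ k * ∑ t : Set.powersetCard (Fin g) k, ∑ m : UIndex g,
      (vCount g (n - (symWt m - setWt (t : Finset (Fin g)))) : ℚ) := by
  rw [qEulerChar, HahnSeries.coeff_sum]
  refine Finset.sum_congr rfl fun k _ => ?_
  rw [← ch_coeff hg]
  rcases Nat.even_or_odd k with h | h
  · rw [h.neg_one_pow, h.neg_one_pow, one_mul, one_mul]
  · rw [h.neg_one_pow, h.neg_one_pow, neg_one_mul, neg_one_mul, HahnSeries.coeff_neg]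

/-- The series is a finite signed sum of shifted copies of the convergent series for the
$v$-monomials, so `sum_eq_eulerFormula` applies over $\mathbb C$ with $P$ the value of that series.
-/
theorem hasSum_qEulerChar (hg : 1 ≤ g) {q : ℂ} (hq0 : q ≠ 0) (hq : ‖q‖ < 1) :
    HasSum (fun n : ℤ => ((qEulerChar g).coeff n : ℂ) * q ^ n) (eulerFormula q g) := by
  have h1 : ∀ i, 0 < i → q ^ i ≠ 1 := fun i hi h => by
    have := pow_norm_lt_one hq hi
    rw [h, norm_one] at this
    exact lt_irrefl _ this
  rw [← sum_eq_eulerFormula (P := ∏ j : Fin g, (1 - q ^ ((j : ℕ) + 2))⁻¹) hq0]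
  · have e : (fun n : ℤ => ((qEulerChar g).coeff n : ℂ) * q ^ n) = fun n =>
        ∑ k ∈ Finset.range (g + 1), (-1) ^ k * ∑ t : Set.powersetCard (Fin g) k,
          ∑ m : UIndex g, (vCount g (n - (symWt m - setWt (t : Finset (Fin g)))) : ℂ) * q ^ n := by
      funext n
      rw [qEulerChar_coeff hg]
      push_cast
      simp only [Finset.sum_mul, mul_assoc]
    rw [e]
    exact hasSum_sum fun k _ => (hasSum_sum fun t _ => hasSum_sum fun m _ =>
      hasSum_vCount_sub hq0 hq _).mul_left _
  · intro i hi
    rw [Finset.mem_Icc] at hi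
    exact h1 i (by omega)
  · rw [← Finset.prod_mul_distrib]
    exact Finset.prod_eq_one fun j _ =>
      inv_mul_cancel₀ (sub_ne_zero.mpr (h1 _ (by omega)).symm)

end convergence

/-! ### The limit `q → 1` -/

section limit

/-- Isolates the zero of order $n$ at $q=1$; the cofactor is a polynomial with value $n!$ there. -/
lemma qFact_eq (q : ℂ) (n : ℕ) : qFact q n =
    (1 - q) ^ n * ∏ i ∈ Finset.Icc 1 n, ∑ j ∈ Finset.range i, q ^ j := by
  have h : ∀ i ∈ Finset.Icc 1 n, qInt q i = (1 - q) * ∑ j ∈ Finset.range i, q ^ j :=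
    fun i _ => (mul_neg_geom_sum q i).symm
  rw [qFact, Finset.prod_congr rfl h, Finset.prod_mul_distrib, Finset.prod_const, Nat.card_Icc,
    Nat.add_sub_cancel]

lemma catalan_identity {g : ℕ} (hg : 1 ≤ g) :
    ((2 * g + 2).factorial / ((g + 1).factorial * (g + 2).factorial) : ℂ) =
      ((2 * g + 1).choose g : ℂ) - ((2 * g + 1).choose (g - 1) : ℂ) := by
  -- Writing $g=h+1$ removes the truncated subtraction in $g-1$.
  obtain ⟨h, rfl⟩ := Nat.exists_eq_add_of_le' hg
  rw [Nat.cast_choose ℂ (show h + 1 ≤ 2 * (h + 1) + 1 by omega), Nat.add_sub_cancel,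
    Nat.cast_choose ℂ (show h ≤ 2 * (h + 1) + 1 by omega),
    show 2 * (h + 1) + 1 - (h + 1) = h + 2 by omega, show 2 * (h + 1) + 1 - h = h + 3 by omega,
    show 2 * (h + 1) + 2 = 2 * (h + 1) + 1 + 1 by omega, Nat.factorial_succ (2 * (h + 1) + 1)]
  simp only [Nat.factorial_succ]
  have h0 : (h.factorial : ℂ) ≠ 0 := Nat.cast_ne_zero.mpr h.factorial_ne_zero
  have h1 : (h : ℂ) + 1 ≠ 0 := by exact_mod_cast Nat.succ_ne_zero h
  have h2 : (h : ℂ) + 1 + 1 ≠ 0 := by exact_mod_cast Nat.succ_ne_zero (h + 1)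
  have h3 : (h : ℂ) + 2 + 1 ≠ 0 := by exact_mod_cast Nat.succ_ne_zero (h + 2)
  push_cast
  field_simp
  ring

/-- The numerator $[1]_q[2g+2]_q!$ and the denominator $[g+1]_q!\,[g+2]_q!$ both contain
$(1-q)^{2g+3}$. After cancellation the quotient is continuous at $1$, with value
$(2g+2)!/((g+1)!\,(g+2)!)$. -/
theorem tendsto_eulerFormula {g : ℕ} (hg : 1 ≤ g) :
    Filter.Tendsto (fun q : ℂ => eulerFormula q g) (nhdsWithin 1 {1}ᶜ)
      (nhds ((-1) ^ g * (((2 * g + 1).choose g : ℂ) - ((2 * g + 1).choose (g - 1) : ℂ)))) := by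
  set S : ℕ → ℂ → ℂ := fun n q => ∏ i ∈ Finset.Icc 1 n, ∑ j ∈ Finset.range i, q ^ j with hS
  have hS1 : ∀ n, S n 1 = n.factorial := fun n => by
    simp only [hS, one_pow, Finset.sum_const, Finset.card_range, nsmul_eq_mul, mul_one]
    induction n with
    | zero => simp
    | succ n ih =>
      rw [Finset.prod_Icc_succ_top (by omega), ih, Nat.factorial_succ, Nat.cast_mul, mul_comm]
  have hSc : ∀ n, ContinuousAt (S n) 1 := fun n => by
    have : Continuous (S n) := by fun_prop
    exact this.continuousAt
  have hSne : ∀ n, S n 1 ≠ 0 := fun n => by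
    rw [hS1]
    exact Nat.cast_ne_zero.mpr n.factorial_ne_zero
  set F : ℂ → ℂ := fun q => (-1) ^ g * q ^ (-((g * (g + 1) / 2 : ℕ) : ℤ)) *
    (S (2 * g + 2) q / (S (g + 1) q * S (g + 2) q)) with hF
  have hFc : ContinuousAt F 1 :=
    (continuousAt_const.mul (continuousAt_zpow₀ _ _ (Or.inl one_ne_zero))).mul
      ((hSc _).div ((hSc _).mul (hSc _)) (mul_ne_zero (hSne _) (hSne _)))
  have hF1 : F 1 = (-1) ^ g * (((2 * g + 1).choose g : ℂ) - ((2 * g + 1).choose (g - 1) : ℂ)) := by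
    rw [← catalan_identity hg]
    simp only [hF, hS1, one_zpow, mul_one]
  rw [← hF1]
  refine (hFc.tendsto.mono_left nhdsWithin_le_nhds).congr' ?_
  filter_upwards [self_mem_nhdsWithin] with q hq
  have hq' : (1 - q) ≠ 0 := sub_ne_zero.mpr fun h => hq h.symm
  rw [eulerFormula, qFact_eq, qFact_eq, qFact_eq, qInt, pow_one]
  simp only [hF]
  congr 1
  have e : (1 - q) * ((1 - q) ^ (2 * g + 2) * S (2 * g + 2) q) =
      (1 - q) ^ (2 * g + 3) * S (2 * g + 2) q := by ring
  have e' : (1 - q) ^ (g + 1) * S (g + 1) q * ((1 - q) ^ (g + 2) * S (g + 2) q) =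
      (1 - q) ^ (2 * g + 3) * (S (g + 1) q * S (g + 2) q) := by ring
  exact (((congrArg₂ (· / ·) e e').trans (mul_div_mul_left _ _ (pow_ne_zero _ hq')))).symm

end limit

end EvenMumford

end

theorem mainTheorem7 (g : ℕ) (hg : 1 ≤ g) :
    (∀ (k : ℕ) (n : ℤ), Module.Finite ℂ (EvenMumford.gradedPart g k n)) ∧
    EvenMumford.qEulerChar g =
      EvenMumford.eulerFormula (HahnSeries.single (1 : ℤ) (1 : ℚ) : LaurentSeries ℚ) g ∧
    (∀ q : ℂ, q ≠ 0 → ‖q‖ < 1 →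
      HasSum (fun n : ℤ => ((EvenMumford.qEulerChar g).coeff n : ℂ) * q ^ n)
        (EvenMumford.eulerFormula q g)) ∧
    Filter.Tendsto (fun q : ℂ => EvenMumford.eulerFormula q g) (nhdsWithin 1 {1}ᶜ)
      (nhds ((-1) ^ g * (((2 * g + 1).choose g : ℂ) - ((2 * g + 1).choose (g - 1) : ℂ)))) ∧
    Filter.Tendsto (fun q : ℂ => ∑' n : ℤ, ((EvenMumford.qEulerChar g).coeff n : ℂ) * q ^ n)
      (nhdsWithin 1 (Metric.ball 0 1))
      (nhds ((-1) ^ g * (((2 * g + 1).choose g : ℂ) - ((2 * g + 1).choose (g - 1) : ℂ)))) := by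
  refine ⟨EvenMumford.finite_gradedPart hg, EvenMumford.qEulerChar_eq hg,
    fun q hq0 hq => EvenMumford.hasSum_qEulerChar hg hq0 hq, EvenMumford.tendsto_eulerFormula hg, ?_⟩
  have hsub : Metric.ball (0 : ℂ) 1 ⊆ {1}ᶜ := by
    rintro q hq rfl
    simp at hq
  refine ((EvenMumford.tendsto_eulerFormula hg).mono_left (nhdsWithin_mono _ hsub)).congr' ?_
  -- The sum is known only for $q\ne0$, which holds near $1$.
  filter_upwards [self_mem_nhdsWithin, nhdsWithin_le_nhds (isOpen_ne.mem_nhds one_ne_zero)]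
    with q hq hq0
  exact (EvenMumford.hasSum_qEulerChar hg hq0 (mem_ball_zero_iff.mp hq)).tsum_eq.symm
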